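/- Let $G=(V,E)$ be a finite simple undirected graph. A function $f:V\to\{0,1,2\}$ is a Roman dominating function of $G$ if every vertex $v$ with $f(v)=0$ has a neighbor $u$ with $f(u)=2$; it is a minimal Roman dominating function if, in addition, no Roman dominating function $g\neq f$ of $G$ satisfies $g(v)\le f(v)$ for all $v\in V$. (1) Every forest (acyclic graph) of order $n$ has at most $\sqrt3^{\,n}$ minimal Roman dominating functions. (2) The minimal Roman dominating functions of forests can be enumerated within this time up to a polynomial factor, i.e. in total time $\mathcal O^*(\sqrt3^{\,n})$, with polynomial delay and in polynomial space. That is, there are a random access machine (with read-only input, addition and truncated subtraction as its only arithmetic instructions, and write-only output) and polynomials $p,d,b$ such that, given the adjacency matrix of any forest on the vertices $0,\dots,n-1$, the machine outputs each minimal Roman dominating function, as the list of its $n$ values, exactly once and then halts; it performs at most $p(n)\,\sqrt3^{\,n}$ steps in total; at most $d(n)$ steps pass before the first output, between two consecutive outputs, and between the last output and halting; and at each moment the nonzero cells of its working memory (addresses and contents) take at most $b(n)$ bits. (3) The bound in (1) is tight: for every $m\ge 0$, the disjoint union of $m$ copies of the path $P_2$ is a forest of order $n=2m$ with exactly $\sqrt3^{\,n}=3^m$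 minimal Roman dominating functions. -/

import Mathlib

noncomputable section

/-! ## Roman dominating functions -/

namespace Roman

/-- `f : V → {0,1,2}` is a Roman dominating function of `G`: every vertex of value `0` has a
neighbor of value `2`. -/
def IsRDF {V : Type*} (G : SimpleGraph V) (f : V → Fin 3) : Prop :=
  ∀ v, f v = 0 → ∃ u, G.Adj v u ∧ f u = 2

/-- Minimal Roman dominating functions: minimal among all Roman dominating functions for the
pointwise order on `V → {0,1,2}`. -/
def IsMinimalRDF {V : Type*} (G : SimpleGraph V) (f : V → Fin 3) : Prop :=
  Minimal (IsRDF G) f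

/-- The disjoint union of `m` copies of the path `P₂` on two vertices. -/
def disjointP2 (m : ℕ) : SimpleGraph (Fin m × Fin 2) where
  Adj x y := x.1 = y.1 ∧ x.2 ≠ y.2
  symm := ⟨fun _ _ h => ⟨h.1.symm, h.2.symm⟩⟩
  loopless := ⟨fun _ h => h.2 rfl⟩

end Roman

/-! ## Random access machines that enumerate

A machine has a read-only input array `x : ℕ → ℕ`, a working memory of cells indexed by `ℕ` that
hold natural numbers and are `0` initially, and a write-only output tape on which it writes a
sequence of finite records. Its only arithmetic instructions are addition and truncated
subtraction. Each instruction takes one step. -/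

namespace RAM

/-- Instructions; `M[a]` is the content of the memory cell with address `a`. -/
inductive Instr where
  /-- `M[a] := c` -/
  | const (a c : ℕ)
  /-- `M[a] := M[b] + M[c]` -/
  | add (a b c : ℕ)
  /-- `M[a] := max (M[b] - M[c]) 0` -/
  | sub (a b c : ℕ)
  /-- `M[a] := M[M[b]]` -/
  | load (a b : ℕ)
  /-- `M[M[a]] := M[b]` -/
  | store (a b : ℕ)
  /-- `M[a] := x[M[b]]`, where `x` is the input -/
  | read (a b : ℕ)
  /-- continue with instruction number `l` -/
  | jump (l : ℕ)
  /-- continue with instruction number `l` if `M[a] = 0` -/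
  | jumpZero (a l : ℕ)
  /-- append `M[a]` to the current output record -/
  | write (a : ℕ)
  /-- finish the current output record and start a new, empty one -/
  | emit

/-- A program is a finite list of instructions, numbered from `0`. -/
abbrev Program := List Instr

/-- Configurations: program counter, memory, unfinished output record, finished output records
(in the order in which they were finished). -/
structure Config where
  pc : ℕ
  mem : ℕ →₀ ℕ
  cur : List ℕ
  out : List (List ℕ)

/-- The initial configuration. -/
def init : Config := ⟨0, 0, [], []⟩

/-- The effect of one instruction on input `x`. -/
def exec (x : ℕ → ℕ) (s : Config) : Instr → Config
  | .const a c => { s with pc := s.pc + 1, mem := s.mem.update a c }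
  | .add a b c => { s with pc := s.pc + 1, mem := s.mem.update a (s.mem b + s.mem c) }
  | .sub a b c => { s with pc := s.pc + 1, mem := s.mem.update a (s.mem b - s.mem c) }
  | .load a b => { s with pc := s.pc + 1, mem := s.mem.update a (s.mem (s.mem b)) }
  | .store a b => { s with pc := s.pc + 1, mem := s.mem.update (s.mem a) (s.mem b) }
  | .read a b => { s with pc := s.pc + 1, mem := s.mem.update a (x (s.mem b)) }
  | .jump l => { s with pc := l }
  | .jumpZero a l => { s with pc := if s.mem a = 0 then l else s.pc + 1 }
  | .write a => { s with pc := s.pc + 1, cur := s.cur ++ [s.mem a] }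
  | .emit => { s with pc := s.pc + 1, cur := [], out := s.out ++ [s.cur] }

/-- One step of program `P` on input `x`. If there is no instruction with number `pc`, the machine
has halted and its configuration no longer changes. -/
def step (P : Program) (x : ℕ → ℕ) (s : Config) : Config :=
  match P[s.pc]? with
  | none => s
  | some i => exec x s i

/-- The configuration of program `P` on input `x` after `t` steps. -/
def run (P : Program) (x : ℕ → ℕ) (t : ℕ) : Config := (step P x)^[t] init

/-- The machine has halted. -/
def Halted (P : Program) (s : Config) : Prop := P.length ≤ s.pc

/-- The number of bits needed to write down the addresses and the contents of all nonzero cells of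
the working memory. -/
def space (m : ℕ →₀ ℕ) : ℕ := ∑ a ∈ m.support, (Nat.size a + Nat.size (m a))

/-- On input `x`, program `P` lists the elements of `S`, each exactly once, and halts. The total
number of steps is at most `T`. Until the machine halts, any `d` consecutive steps finish at least
one record; so at most `d` steps pass before the first record, between two consecutive ones, and
from the last one until the machine halts. The working memory never takes more than `b` bits. -/
def Enumerates (P : Program) (x : ℕ → ℕ) (S : Set (List ℕ)) (T : ℝ) (d b : ℕ) : Prop :=
  ∃ t : ℕ, (t : ℝ) ≤ T ∧ Halted P (run P x t) ∧
    (run P x t).cur = [] ∧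
    (run P x t).out.Nodup ∧
    (∀ w, w ∈ (run P x t).out ↔ w ∈ S) ∧
    (∀ r, r + d ≤ t → (run P x r).out.length < (run P x (r + d)).out.length) ∧
    (∀ r, r ≤ t → space (run P x r).mem ≤ b)

open Classical in
/-- A graph on the vertices `0, …, n - 1` as an input: cell `0` holds `n`, followed by the adjacency
matrix, row by row (the entry `(i, j)` is in cell `1 + i * n + j`). -/
def graphInput {n : ℕ} (G : SimpleGraph (Fin n)) (k : ℕ) : ℕ :=
  if k = 0 then n
  else if ∃ i j : Fin n, k = 1 + i * n + j ∧ G.Adj i j then 1 else 0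

/-- The record of `f : {0, …, n - 1} → {0,1,2}`: the list `f(0), …, f(n - 1)` of its values. -/
def record {n : ℕ} (f : Fin n → Fin 3) : List ℕ := List.ofFn fun i => (f i : ℕ)

end RAM

end

/-! A minimal Roman dominating function is determined by the set `D` of vertices of value 2, and the
sets that occur are exactly those in which every member has a private neighbor outside `D`
(`setOf_isMinimalRDF`). All three claims are therefore about such sets.

For the upper bound, give every vertex weight `1/√3` both for being in `D` and for being outside.
The claim becomes that the total weight is at most 1. Each vertex carries a vector of weights
indexed by five states, which describe how it interacts with the part of the forest already hidden
behind it. A pendant vertex is absorbed into its neighbor by the bilinear operation `star`, which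
preserves the total weight (`weight_absorb`), and a vertex with no remaining neighbors contributes a
factor at most `a + z + y + x` (`weight_le_mul_of_forall_adj_neutral`). It remains to see that this
factor never exceeds 1. The vectors that arise are that of a single vertex, that of `P₂`, whose
factor is exactly 1, or vectors satisfying five linear inequalities; this class is closed under
`star` (`Treelike.star`).

For the enumeration, having private neighbors is inherited by subsets (`HasPrivate.mono`). A binary
counter over subsets can thus skip everything below an infeasible prefix: when a set fails the test,
the element just added is removed and the carry moves on. Each digit costs one polynomial test, so
at most `n` tests separate consecutive outputs (`finishes_of_atOut`). The total time is at most the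
delay times the number of outputs plus one, and the first part bounds that number
(`enumerates_prog`).

For tightness, a set in a disjoint union of copies of `P₂` is feasible exactly when it contains at
most one end of each edge, which leaves three choices per copy. -/

noncomputable section

namespace Roman

/-! ### States of vertices and the absorption of a pendant vertex -/

section

/-- States of a vertex that stands for a rooted part of a forest: `a` in the set and already having
a private neighbor, `e` in the set and still lacking one, `z` outside and not dominated, `x` outside
and the only private neighbor of a hidden neighbor, `y` outside and otherwise unconstrained. -/
inductive St | a | e | z | y | x
  deriving DecidableEq

open St

instance : Fintype St := ⟨{a, e, z, y, x}, fun s => by cases s <;> simp⟩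

/-- The vertex belongs to the set. -/
def St.sel (s : St) : Prop := s = a ∨ s = e

/-- The state of a vertex after absorbing a pendant neighbor. -/
def St.absorb : St → St → Option St
  | a, a => some a | a, z => some a | a, y => some a
  | e, z => some a | e, a => some e | e, y => some e
  | z, z => some z | z, y => some z | z, x => some z | z, a => some y | z, e => some x
  | y, a => some y | y, z => some y | y, y => some y | y, x => some y
  | x, z => some x | x, y => some x | x, x => some x
  | _, _ => none

/-- Every vertex of state `e` has a private neighbor of state `z`, and no vertex of state `x` has a
selected neighbor. -/
def Valid {V : Type*} (G : SimpleGraph V) (σ : V → St) : Prop :=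
  (∀ v, σ v = x → ∀ u, G.Adj v u → ¬ (σ u).sel) ∧
  (∀ v, σ v = e → ∃ u, G.Adj v u ∧ σ u = z ∧ ∀ w, G.Adj u w → (σ w).sel → w = v)

/-- A component is a tree, hence a single vertex or a tree with a leaf. Isolated vertices are
included so that one lemma drives the whole elimination. -/
theorem exists_adj_unique_of_isAcyclic {V : Type*} [Finite V] [Nonempty V] {G : SimpleGraph V}
    (hG : G.IsAcyclic) : ∃ v, ∀ u w, G.Adj v u → G.Adj v w → u = w := by
  classical
  have := Fintype.ofFinite V
  obtain ⟨v0⟩ := ‹Nonempty V›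
  set c := G.connectedComponentMk v0
  have ht := hG.isTree_connectedComponent c
  have hc : ∀ {v u}, v ∈ c.supp → G.Adj v u → u ∈ c.supp := fun hv h =>
    (c.mem_supp_congr_adj h).1 hv
  rcases subsingleton_or_nontrivial c.supp with hs | hs
  · refine ⟨v0, fun u w hu _ => ?_⟩
    have h0 : v0 ∈ c.supp := rfl
    have := congrArg Subtype.val (Subsingleton.elim (⟨v0, h0⟩ : c.supp) ⟨u, hc h0 hu⟩)
    exact absurd this hu.ne
  · obtain ⟨v, hv⟩ := ht.exists_vert_degree_one_of_nontrivial
    rw [SimpleGraph.degree_eq_one_iff_existsUnique_adj] at hv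
    refine ⟨v, fun u w hu hw => ?_⟩
    have := hv.unique (y₁ := ⟨u, hc v.2 hu⟩) (y₂ := ⟨w, hc v.2 hw⟩)
      (by simpa [SimpleGraph.ConnectedComponent.toSimpleGraph] using hu)
      (by simpa [SimpleGraph.ConnectedComponent.toSimpleGraph] using hw)
    exact congrArg Subtype.val this

/-- The graph is never changed. An absorbed vertex is parked in state `y`, which is neither
selected, nor available as a private neighbor, nor constrained, so it is as good as deleted. The
entries of `absorb` that matter most: `e, z` gives `a` because `l` becomes the private neighbor of
`p`; `z, e` gives `x` because `p` must serve `l` alone; `z, a` gives `y` because `p` is now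
dominated. -/
theorem valid_iff_absorb {V : Type*} {G : SimpleGraph V} {p l : V} (hpl : G.Adj p l)
    {σ τ : V → St} (hl : ∀ u, G.Adj l u → u ≠ p → τ u = y)
    (hστ : ∀ u, u ≠ p → u ≠ l → σ u = τ u) (hτ : τ l = y) (hab : (σ p).absorb (σ l) = some (τ p)) :
    Valid G σ ↔ Valid G τ := by
  have h1 : p ≠ l := hpl.ne
  have h2 := hpl.symm
  have h3 : ∀ u, G.Adj u l → u = p ∨ τ u = y := fun u h => or_iff_not_imp_left.2 (hl u h.symm)
  have h4 : ∀ u, G.Adj l u → u = p ∨ τ u = y := fun u h => or_iff_not_imp_left.2 (hl u h)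
  have h5 : ∀ u, u = p ∨ u = l ∨ σ u = τ u := fun u => by
    by_cases a1 : u = p <;> by_cases a2 : u = l <;> simp_all
  clear hl hστ
  generalize hs : σ p = s at *
  generalize ht : σ l = t at *
  generalize hm : τ p = m at *
  unfold Valid
  unfold St.sel
  cases s <;> cases t <;> simp only [St.absorb, Option.some.injEq, reduceCtorEq] at hab <;>
    subst hab <;>
    constructor <;> rintro ⟨hx, he⟩ <;> refine ⟨fun v hv u hu => ?_, fun v hv => ?_⟩ <;>
    grind

/-- The missing entries of `absorb` put an `x` next to a selected vertex, or put `l` in state `e`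
while `p`, its only possible private neighbor, is not in state `z`. -/
theorem absorb_isSome_of_valid {V : Type*} {G : SimpleGraph V} {p l : V} (hpl : G.Adj p l)
    {σ : V → St} (hl : ∀ u, G.Adj l u → u ≠ p → σ u = y) (h : Valid G σ)  :
    ((σ p).absorb (σ l)).isSome := by
  have h2 := hpl.symm
  obtain ⟨hx, he⟩ := h
  have a1 := hx p
  have a2 := hx l
  have a3 := he p
  have a4 := he l
  generalize hs : σ p = s at *
  generalize ht : σ l = t at *
  unfold St.sel at *
  cases s <;> cases t <;> simp only [St.absorb, Option.isSome] <;> exfalso <;> grind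

/-- The weights of the states after absorbing a pendant neighbor of weights `t`. -/
def star (s t : St → ℝ) : St → ℝ
  | a => s a * (t a + t z + t y) + s e * t z
  | e => s e * (t a + t y)
  | z => s z * (t z + t y + t x)
  | y => s y * (t a + t z + t y + t x) + s z * t a
  | x => s x * (t z + t y + t x) + s z * t e

theorem sum_St {M : Type*} [AddCommMonoid M] (φ : St → M) :
    ∑ m, φ m = φ a + (φ e + (φ z + (φ y + φ x))) := by
  change ∑ m ∈ ({a, e, z, y, x} : Finset St), φ m = _
  simp

theorem sum_absorb (s t φ : St → ℝ) :
    ∑ i, ∑ j, s i * t j * ((i.absorb j).elim 0 φ) = ∑ m, star s t m * φ m := by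
  simp only [sum_St, absorb, star, Option.elim]
  ring

theorem Valid.update_neutral {V : Type*} [DecidableEq V] {G : SimpleGraph V} {l : V}
    {σ : V → St} (h : Valid G σ)
    (hl : ∀ u, G.Adj l u → σ u = y) : Valid G (Function.update σ l y) ∧ σ l ≠ e := by
  have h3 : ∀ u, G.Adj u l → σ u = y := fun u h => hl u h.symm
  have h5 : ∀ u, u = l ∨ Function.update σ l y u = σ u := fun u => by
    by_cases a2 : u = l <;> simp_all
  have h6 : Function.update σ l y l = y := by simp
  generalize Function.update σ l y = τ at *
  unfold Valid sel at *
  obtain ⟨hx, he⟩ := h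
  refine ⟨⟨fun v hv u hu => ?_, fun v hv => ?_⟩, ?_⟩ <;> grind

/-! ### Weighted sums over valid assignments -/

variable {V : Type*} [Fintype V]

-- Summation along the fibers of forgetting the state at `p`; the assignment with value `s0` at `p`
-- represents its fiber.
open Classical in
theorem sum_update_eq {M : Type*} [AddCommMonoid M] (p : V) (s0 : St) (f : (V → St) → M) :
    ∑ σ, f σ = ∑ σ : V → St, if σ p = s0 then ∑ s, f (Function.update σ p s) else 0 := by
  rw [← (Equiv.funSplitAt p St).symm.sum_comp, ← (Equiv.funSplitAt p St).symm.sum_comp,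
    Fintype.sum_prod_type_right, Fintype.sum_prod_type_right]
  refine Finset.sum_congr rfl fun r _ => ?_
  have h1 : ∀ s, (Equiv.funSplitAt p St).symm (s, r) p = s := fun s => by simp
  have h2 : ∀ s s', Function.update ((Equiv.funSplitAt p St).symm (s, r)) p s' =
      (Equiv.funSplitAt p St).symm (s', r) := fun s s' => by
    ext v
    by_cases h : v = p
    · subst h; simp
    · simp [h]
  simp only [h1, h2]
  rw [Finset.sum_ite_eq' Finset.univ s0]
  simp

open Classical in
theorem sum_update_update_eq {M : Type*} [AddCommMonoid M] {p l : V} (hne : l ≠ p) (s0 : St)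
    (f : (V → St) → M) :
    ∑ σ, f σ = ∑ σ : V → St, if σ l = s0 ∧ σ p = s0 then
      ∑ t, ∑ s, f (Function.update (Function.update σ l t) p s) else 0 := by
  rw [sum_update_eq p s0, sum_update_eq l s0]
  refine Finset.sum_congr rfl fun σ _ => ?_
  simp only [Function.update_of_ne hne.symm]
  by_cases h1 : σ l = s0 <;> by_cases h2 : σ p = s0 <;> simp [h1, h2]

open Classical in
/-- The total weight of the valid assignments of states. -/
def weight (G : SimpleGraph V) (w : V → St → ℝ) : ℝ :=
  ∑ σ : V → St, if Valid G σ then ∏ v, w v (σ v) else 0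

/-- The weights of a vertex without any influence. -/
def neutral : St → ℝ := Pi.single y 1

-- Fix the states away from `p` and `l`. On such a fiber validity depends on the two remaining
-- states only through `absorb`, and `star` collects the weights of the pairs with a given result.
open Classical in
theorem weight_absorb {G : SimpleGraph V} {p l : V} (hpl : G.Adj p l) (w : V → St → ℝ)
    (hl : ∀ u, G.Adj l u → u ≠ p → w u = neutral) :
    weight G w =
      weight G (Function.update (Function.update w p (star (w p) (w l))) l neutral) := by
  have hne : l ≠ p := hpl.ne'
  set w' := Function.update (Function.update w p (star (w p) (w l))) l neutral with hw'
  unfold weight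
  rw [sum_update_update_eq hne y, sum_update_update_eq hne y (fun σ => ite (Valid G σ) _ 0)]
  refine Finset.sum_congr rfl fun σ _ => ?_
  split_ifs with hσ
  swap; · rfl
  set S := ((Finset.univ : Finset V).erase p).erase l with hS
  have hprod : ∀ (w : V → St → ℝ) (t s : St),
      ∏ v, w v (Function.update (Function.update σ l t) p s v) =
        w p s * w l t * ∏ v ∈ S, w v (σ v) := fun w t s => by
    rw [← Finset.mul_prod_erase _ _ (Finset.mem_univ p),
      ← Finset.mul_prod_erase _ _ (Finset.mem_erase.2 ⟨hne, Finset.mem_univ l⟩), ← mul_assoc]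
    congr 1
    · simp [hne]
    · refine Finset.prod_congr rfl fun v hv => ?_
      simp only [hS, Finset.mem_erase] at hv
      simp [hv.1, hv.2.1]
  have hR : ∏ v ∈ S, w' v (σ v) = ∏ v ∈ S, w v (σ v) := Finset.prod_congr rfl fun v hv => by
    simp only [hS, Finset.mem_erase] at hv
    simp [hw', hv.1, hv.2.1]
  simp only [hprod, hR]
  have hw'p : w' p = star (w p) (w l) := by simp [hw', hne.symm]
  have hw'l : w' l = neutral := by simp [hw']
  -- A nonzero product forces every vertex with neutral weights into state `y`, which supplies the
  -- hypothesis on the other neighbors of `l`.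
  by_cases h0 : ∏ v ∈ S, w v (σ v) = 0
  · simp [h0]
  have hy : ∀ u, G.Adj l u → u ≠ p → σ u = y := fun u hu hup => by
    have : w u (σ u) ≠ 0 := (Finset.prod_ne_zero_iff.1 h0) u (by simp [hS, hup, hu.ne'])
    rw [hl u hu hup, neutral] at this
    by_contra h
    exact this (Pi.single_eq_of_ne h _)
  set φ : St → ℝ := fun m =>
    if Valid G (Function.update (Function.update σ l y) p m) then 1 else 0 with hφ
  have hval : ∀ s t, (if Valid G (Function.update (Function.update σ l t) p s) then (1 : ℝ) else 0)
      = (s.absorb t).elim 0 φ := fun s t => by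
    have hadj : ∀ u, G.Adj l u → u ≠ p → ∀ s t,
        Function.update (Function.update σ l t) p s u = y := fun u hu hup s t => by
      simp [hup, hu.ne', hy u hu hup]
    rcases h : s.absorb t with _ | m
    · rw [if_neg]
      · rfl
      · intro hv
        have := absorb_isSome_of_valid hpl (fun u hu hup => hadj u hu hup s t) hv
        simp [hne, h] at this
    · have := valid_iff_absorb hpl (σ := Function.update (Function.update σ l t) p s)
        (τ := Function.update (Function.update σ l y) p m)
        (fun u hu hup => hadj u hu hup m y) (fun u hup hul => by simp [hup, hul])
        (by simp [hne]) (by simp [hne, h])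
      simp [this, hφ]
  have e1 : ∀ (w : V → St → ℝ) (s t : St), (if Valid G (Function.update (Function.update σ l t) p s)
      then w p s * w l t * ∏ v ∈ S, w v (σ v) else 0) =
      (w p s * w l t * if Valid G (Function.update (Function.update σ l t) p s) then 1 else 0) *
        ∏ v ∈ S, w v (σ v) := fun w s t => by split_ifs <;> simp
  have e2 : ∀ (t s : St), (if Valid G (Function.update (Function.update σ l t) p s)
      then w' p s * w' l t * ∏ v ∈ S, w v (σ v) else 0) =
      (if t = y then star (w p) (w l) s * φ s else 0) *
        ∏ v ∈ S, w v (σ v) := fun t s => by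
    rw [hw'p, hw'l, neutral]
    by_cases ht : t = y
    · subst ht; simp [hφ]
    · simp [ht]
  simp only [e1, e2, hval]
  simp only [← Finset.sum_mul]
  congr 1
  rw [Finset.sum_comm, sum_absorb, Finset.sum_comm]
  simp

-- All neighbors of `l` that contribute are in state `y`, so `l` cannot be in state `e`: no private
-- neighbor is left. The other four states give the factor.
open Classical in
theorem weight_le_mul_of_forall_adj_neutral {G : SimpleGraph V} (l : V) (w : V → St → ℝ)
    (hw : ∀ v s, 0 ≤ w v s) (hl : ∀ u, G.Adj l u → w u = neutral) :
    weight G w ≤ (w l a + w l z + w l y + w l x) *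
      weight G (Function.update w l neutral) := by
  set w' := Function.update w l neutral with hw'
  unfold weight
  rw [sum_update_eq l y, sum_update_eq l y (fun σ => ite (Valid G σ) _ 0), Finset.mul_sum]
  refine Finset.sum_le_sum fun σ _ => ?_
  split_ifs with hσ
  swap; · simp
  set S := (Finset.univ : Finset V).erase l with hS
  have hprod : ∀ (w : V → St → ℝ) (s : St), ∏ v, w v (Function.update σ l s v) =
        w l s * ∏ v ∈ S, w v (σ v) := fun w s => by
    rw [← Finset.mul_prod_erase _ _ (Finset.mem_univ l)]
    congr 1
    · simp
    · refine Finset.prod_congr rfl fun v hv => ?_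
      simp only [hS, Finset.mem_erase] at hv
      simp [hv.1]
  have hR : ∏ v ∈ S, w' v (σ v) = ∏ v ∈ S, w v (σ v) := Finset.prod_congr rfl fun v hv => by
    simp only [hS, Finset.mem_erase] at hv
    simp [hw', hv.1]
  have hw'l : w' l = neutral := by simp [hw']
  simp only [hprod, hR, hw'l]
  have hR0 : 0 ≤ ∏ v ∈ S, w v (σ v) := Finset.prod_nonneg fun v _ => hw v _
  by_cases h0 : ∏ v ∈ S, w v (σ v) = 0
  · simp [h0]
  have hy : ∀ u, G.Adj l u → σ u = y := fun u hu => by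
    have : w u (σ u) ≠ 0 := (Finset.prod_ne_zero_iff.1 h0) u (by simp [hS, hu.ne'])
    rw [hl u hu, neutral] at this
    by_contra h
    exact this (Pi.single_eq_of_ne h _)
  have hval : ∀ s, Valid G (Function.update σ l s) → Valid G (Function.update σ l y) ∧ s ≠ e :=
    fun s hs => by
      simpa using hs.update_neutral (l := l) (fun u hu => by simp [hu.ne', hy u hu])
  have key : ∀ s, (if Valid G (Function.update σ l s) then w l s * ∏ v ∈ S, w v (σ v) else 0) ≤
      if Valid G (Function.update σ l y) ∧ s ≠ e then w l s * ∏ v ∈ S, w v (σ v) else 0 :=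
    fun s => by
      have := mul_nonneg (hw l s) hR0
      have := hval s
      split_ifs <;> tauto
  refine (Finset.sum_le_sum fun s _ => key s).trans (le_of_eq ?_)
  by_cases hv : Valid G (Function.update σ l y)
  · simp [sum_St, neutral, hv]
    ring
  · simp [hv, sum_St, neutral]

theorem weight_le_one_of_neutral (G : SimpleGraph V) :
    weight G (fun _ => neutral) ≤ 1 := by
  classical
  have h1 : ∏ _v : V, ∑ s, neutral s = 1 := by simp [neutral]
  rw [← h1, Finset.prod_univ_sum]
  simp only [Fintype.piFinset_univ, weight]
  refine Finset.sum_le_sum fun σ _ => ?_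
  have : 0 ≤ ∏ v, neutral (σ v) := Finset.prod_nonneg fun v _ => by
    unfold neutral; exact (Pi.single_nonneg.2 zero_le_one : (0 : St → ℝ) ≤ _) _
  split_ifs <;> simp [this]

/-! ### Inequalities for the weights of rooted trees -/

/-- The weights of a single vertex. -/
def leafWeight : St → ℝ
  | e => (√3)⁻¹ | z => (√3)⁻¹ | _ => 0

/-- The weights of a path on two vertices. -/
def edgeWeight : St → ℝ
  | a => 1 / 3 | z => 1 / 3 | x => 1 / 3 | _ => 0

/-- Bounds on the weights of a rooted tree on at least three vertices. -/
structure Small (s : St → ℝ) : Prop where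
  nonneg : ∀ i, 0 ≤ s i
  total : s a + s z + s y + s x ≤ 0.84
  total' : s a + s e + s z + s y + s x ≤ 1.05
  free : s z ≤ 0.388
  unsel : s z + s y + s x ≤ 0.61
  half : s a + s e / 2 + s z + s y ≤ 0.867

/-- The bounds that hold for the weights of every rooted tree. -/
def Treelike (s : St → ℝ) : Prop := s = leafWeight ∨ s = edgeWeight ∨ Small s

theorem inv_sqrt_three_mul_self : (√3)⁻¹ * (√3)⁻¹ = 1 / 3 := by
  rw [← mul_inv, Real.mul_self_sqrt (by norm_num)]; norm_num

theorem inv_sqrt_three_lt : (√3)⁻¹ < 0.57736 := by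
  have := inv_sqrt_three_mul_self
  have : 0 ≤ (√3)⁻¹ := by positivity
  nlinarith

theorem star_nonneg {s t : St → ℝ} (hs : ∀ i, 0 ≤ s i) (ht : ∀ i, 0 ≤ t i) (i : St) :
    0 ≤ star s t i := by
  have := fun i j => mul_nonneg (hs i) (ht j)
  cases i <;> simp only [star, mul_add] <;>
    linarith [this a a, this a z, this a y, this e z, this e a, this e y, this z z, this z y,
      this z x,
      this y a, this y z, this y y, this y x, this z a, this x z, this x y, this x x, this z e]

theorem leafWeight_nonneg (i : St) : 0 ≤ leafWeight i := by
  cases i <;> simp [leafWeight]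

theorem edgeWeight_nonneg (i : St) : 0 ≤ edgeWeight i := by
  cases i <;> norm_num [edgeWeight]

/-- The empty set, the root and the leaf of `P₂` yield the states `z`, `a` and `x`. Their weights
add up to exactly 1, the extremal case. -/
theorem star_leafWeight_leafWeight : star leafWeight leafWeight = edgeWeight := by
  have := inv_sqrt_three_mul_self
  funext i
  cases i <;> simp [star, leafWeight, edgeWeight] <;> linarith

theorem Small.leafWeight_star {t : St → ℝ} (ht : Small t) : Small (star leafWeight t) := by
  have hc := inv_sqrt_three_lt
  have hc0 : 0 ≤ (√3)⁻¹ := by positivity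
  obtain ⟨h0, h1, h2, h3, h4, h5⟩ := ht
  have ha := h0 a; have he := h0 e; have hz := h0 z; have hy := h0 y; have hx := h0 x
  constructor
  · exact star_nonneg leafWeight_nonneg h0
  all_goals simp only [star, leafWeight]; nlinarith

theorem Small.star_leafWeight {t : St → ℝ} (ht : Small t) : Small (star t leafWeight) := by
  have hc := inv_sqrt_three_lt
  have hc0 : 0 ≤ (√3)⁻¹ := by positivity
  obtain ⟨h0, h1, h2, h3, h4, h5⟩ := ht
  have ha := h0 a; have he := h0 e; have hz := h0 z; have hy := h0 y; have hx := h0 x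
  constructor
  · exact star_nonneg h0 leafWeight_nonneg
  all_goals simp only [star, leafWeight]; nlinarith

theorem Small.edgeWeight_star {t : St → ℝ} (ht : Small t) : Small (star edgeWeight t) := by
  obtain ⟨h0, h1, h2, h3, h4, h5⟩ := ht
  have ha := h0 a; have he := h0 e; have hz := h0 z; have hy := h0 y; have hx := h0 x
  constructor
  · exact star_nonneg edgeWeight_nonneg h0
  all_goals simp only [star, edgeWeight]; linarith

theorem Small.star_edgeWeight {t : St → ℝ} (ht : Small t) : Small (star t edgeWeight) := by
  obtain ⟨h0, h1, h2, h3, h4, h5⟩ := ht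
  have ha := h0 a; have he := h0 e; have hz := h0 z; have hy := h0 y; have hx := h0 x
  constructor
  · exact star_nonneg h0 edgeWeight_nonneg
  all_goals simp only [star, edgeWeight]; linarith

theorem small_star_edgeWeight_leafWeight : Small (star edgeWeight leafWeight) := by
  have hc := inv_sqrt_three_lt
  have hc0 : 0 ≤ (√3)⁻¹ := by positivity
  constructor
  · exact star_nonneg edgeWeight_nonneg leafWeight_nonneg
  all_goals simp only [star, leafWeight, edgeWeight]; linarith

theorem small_star_leafWeight_edgeWeight : Small (star leafWeight edgeWeight) := by
  have hc := inv_sqrt_three_lt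
  have hc0 : 0 ≤ (√3)⁻¹ := by positivity
  constructor
  · exact star_nonneg leafWeight_nonneg edgeWeight_nonneg
  all_goals simp only [star, leafWeight, edgeWeight]; linarith

theorem small_star_edgeWeight_edgeWeight : Small (star edgeWeight edgeWeight) := by
  constructor
  · exact star_nonneg edgeWeight_nonneg edgeWeight_nonneg
  all_goals norm_num [star, edgeWeight]

/-- In the `total` of `star s t`, the coefficients of `s e`, `s z`, `s y`, `s x` are the forms
`free`, `total'`, `total`, `unsel` of `t`, which explains the choice of these forms. The
certificates combine products of a weight with a slack (`p0`, `q0`) and of two slacks (`r0`). -/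
theorem Small.star {s t : St → ℝ} (hs : Small s) (ht : Small t) : Small (star s t) := by
  obtain ⟨h0, h1, h2, h3, h4, h5⟩ := hs
  have ha := h0 a; have he := h0 e; have hz := h0 z; have hy := h0 y; have hx := h0 x
  obtain ⟨k0, k1, k2, k3, k4, k5⟩ := ht
  have ka := k0 a; have ke := k0 e; have kz := k0 z; have ky := k0 y; have kx := k0 x
  have p0 : ∀ i {r q : ℝ}, q ≤ r → 0 ≤ s i * (r - q) := fun i _ _ h =>
    mul_nonneg (h0 i) (sub_nonneg.2 h)
  have q0 : ∀ i {r q : ℝ}, q ≤ r → 0 ≤ t i * (r - q) := fun i _ _ h =>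
    mul_nonneg (k0 i) (sub_nonneg.2 h)
  have r0 : ∀ {r q r' q' : ℝ}, q ≤ r → q' ≤ r' → 0 ≤ (r - q) * (r' - q') := fun h h' =>
    mul_nonneg (sub_nonneg.2 h) (sub_nonneg.2 h')
  constructor
  · exact star_nonneg h0 k0
  all_goals simp only [Roman.star]
  -- Bounding each coefficient separately allows about 0.851 and misses 0.84, since the forms in `t`
  -- cannot all be extremal at once. Constraints on both factors have to be multiplied.
  · linarith [p0 a k1, p0 a k2, p0 a k4, p0 a k5, p0 e k3, p0 e k5, p0 z k1, p0 z k2, p0 z k5,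
      p0 y k1, p0 y k2, p0 y k5, p0 x k4, q0 a h1, q0 a h2, q0 a h4, q0 a h5, q0 z h1, q0 z h2,
      q0 z h3, q0 z h5, q0 y h1, q0 y h2, q0 y h5, q0 x h1, q0 x h2, q0 x h3, q0 x h4, q0 x h5,
      q0 e h3, q0 e h5, q0 e h2,
      r0 h1 k1, r0 h1 k2, r0 h2 k1, r0 h2 k2, r0 h3 k2, r0 h5 k2, r0 h2 k5, r0 h5 k5,
      r0 h3 k5, r0 h3 k1, r0 h4 k1, r0 h4 k4, r0 h5 k1,
      mul_nonneg ha ke, mul_nonneg he ke]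
  · linarith [p0 a k1, p0 e k1, p0 z k2, p0 y k1, p0 x k4, mul_nonneg ha kx, mul_nonneg he kx]
  · linarith [p0 z k4]
  · linarith [p0 z k2, p0 y k1, p0 x k4, p0 z k1]
  · linarith [p0 a k1, p0 e k3, p0 z k1, p0 y k1, p0 e k1, mul_nonneg ha kx, mul_nonneg he kx]

theorem Treelike.star {s t : St → ℝ} (hs : Treelike s) (ht : Treelike t) :
    Treelike (star s t) := by
  rcases hs with rfl | rfl | hs <;> rcases ht with rfl | rfl | ht
  · exact Or.inr (Or.inl star_leafWeight_leafWeight)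
  · exact Or.inr (Or.inr small_star_leafWeight_edgeWeight)
  · exact Or.inr (Or.inr ht.leafWeight_star)
  · exact Or.inr (Or.inr small_star_edgeWeight_leafWeight)
  · exact Or.inr (Or.inr small_star_edgeWeight_edgeWeight)
  · exact Or.inr (Or.inr ht.edgeWeight_star)
  · exact Or.inr (Or.inr hs.star_leafWeight)
  · exact Or.inr (Or.inr hs.star_edgeWeight)
  · exact Or.inr (Or.inr (hs.star ht))

theorem Treelike.nonneg {s : St → ℝ} (hs : Treelike s) (i : St) : 0 ≤ s i := by
  rcases hs with rfl | rfl | hs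
  exacts [leafWeight_nonneg i, edgeWeight_nonneg i, hs.nonneg i]

theorem Treelike.total_le_one {s : St → ℝ} (hs : Treelike s) : s a + s z + s y + s x ≤ 1 := by
  rcases hs with rfl | rfl | hs
  · have := inv_sqrt_three_lt
    simp only [leafWeight]; linarith
  · norm_num [edgeWeight]
  · linarith [hs.total]

theorem neutral_nonneg (i : St) : 0 ≤ neutral i :=
  (Pi.single_nonneg.2 zero_le_one : (0 : St → ℝ) ≤ _) i

theorem weight_nonneg (G : SimpleGraph V) {w : V → St → ℝ} (hw : ∀ v s, 0 ≤ w v s) :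
    0 ≤ weight G w :=
  Finset.sum_nonneg fun σ _ => by
    have : 0 ≤ ∏ v, w v (σ v) := Finset.prod_nonneg fun v _ => hw v _
    split_ifs <;> simp [this]

/-- `S` holds the vertices not yet absorbed. It induces a forest, so some vertex of `S` has at most
one neighbor in `S` and can be absorbed or split off. -/
theorem weight_le_one {G : SimpleGraph V} (hG : G.IsAcyclic) (S : Finset V) :
    ∀ w : V → St → ℝ, (∀ v ∈ S, Treelike (w v)) → (∀ v ∉ S, w v = neutral) → weight G w ≤ 1 := by
  classical
  induction S using Finset.strongInduction with
  | H S ih =>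
    intro w hS hn
    have hw : ∀ v s, 0 ≤ w v s := fun v s => by
      by_cases h : v ∈ S
      · exact (hS v h).nonneg s
      · rw [hn v h]; exact neutral_nonneg s
    rcases S.eq_empty_or_nonempty with rfl | ⟨v0, hv0⟩
    · have : w = fun _ => neutral := funext fun v => hn v (by simp)
      rw [this]; exact weight_le_one_of_neutral G
    have : Nonempty (S : Set V) := ⟨⟨v0, hv0⟩⟩
    obtain ⟨⟨l, hlS⟩, hl⟩ := exists_adj_unique_of_isAcyclic (hG.induce (S : Set V))
    have hlS' : l ∈ S := hlS
    have hss : S.erase l ⊂ S := Finset.erase_ssubset hlS'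
    by_cases hex : ∃ p ∈ S, G.Adj l p
    · obtain ⟨p, hpS, hlp⟩ := hex
      rw [weight_absorb hlp.symm]
      · refine ih _ hss _ (fun v hv => ?_) fun v hv => ?_
        · obtain ⟨hvl, hvS⟩ := Finset.mem_erase.1 hv
          rw [Function.update_of_ne hvl]
          by_cases hvp : v = p
          · subst hvp
            simpa using (hS _ hpS).star (hS _ hlS')
          · rw [Function.update_of_ne hvp]; exact hS v hvS
        · by_cases hvl : v = l
          · subst hvl; simp
          · have hvS : v ∉ S := fun h => hv (Finset.mem_erase.2 ⟨hvl, h⟩)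
            have hvp : v ≠ p := fun h => hvS (h ▸ hpS)
            simp [hvl, hvp, hn v hvS]
      · intro u hu hup
        refine hn u fun huS => hup ?_
        have := hl ⟨u, huS⟩ ⟨p, hpS⟩ (by simpa using hu) (by simpa using hlp)
        exact congrArg Subtype.val this
    · push Not at hex
      have hle := weight_le_mul_of_forall_adj_neutral (G := G) l w hw
        (fun u hu => hn u fun huS => hex u huS hu)
      have h1 : weight G (Function.update w l neutral) ≤ 1 := by
        refine ih _ hss _ (fun v hv => ?_) fun v hv => ?_
        · obtain ⟨hvl, hvS⟩ := Finset.mem_erase.1 hv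
          rw [Function.update_of_ne hvl]; exact hS v hvS
        · by_cases hvl : v = l
          · subst hvl; simp
          · simp [hvl, hn v fun h => hv (Finset.mem_erase.2 ⟨hvl, h⟩)]
      have h2 := (hS l hlS').total_le_one
      have h3 : 0 ≤ weight G (Function.update w l neutral) := by
        refine weight_nonneg G fun v s => ?_
        by_cases hvl : v = l
        · subst hvl; simpa using neutral_nonneg s
        · simpa [hvl] using hw v s
      nlinarith

end

/-! ### Minimal Roman dominating functions as sets with private neighbors -/

/-- Every vertex of `D` has a private neighbor outside of `D`. -/
def HasPrivate {V : Type*} (G : SimpleGraph V) (D : Set V) : Prop :=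
  ∀ v ∈ D, ∃ u, G.Adj v u ∧ u ∉ D ∧ ∀ w, G.Adj u w → w ∈ D → w = v

theorem HasPrivate.mono {V : Type*} {G : SimpleGraph V} {D E : Set V} (h : HasPrivate G E)
    (hDE : D ⊆ E) : HasPrivate G D := fun v hv => by
  obtain ⟨u, hu, huE, hw⟩ := h v (hDE hv)
  exact ⟨u, hu, fun h => huE (hDE h), fun w h1 h2 => hw w h1 (hDE h2)⟩

open Classical in
/-- The function that has the value `2` on `D`, `0` on the other neighbors of `D` and `1` on all
remaining vertices. -/
def ofSet {V : Type*} (G : SimpleGraph V) (D : Set V) (v : V) : Fin 3 :=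
  if v ∈ D then 2 else if ∃ u, G.Adj v u ∧ u ∈ D then 0 else 1

theorem ofSet_eq_two {V : Type*} {G : SimpleGraph V} {D : Set V} {v : V} :
    ofSet G D v = 2 ↔ v ∈ D := by
  unfold ofSet; split_ifs <;> simp_all

theorem ofSet_eq_zero {V : Type*} {G : SimpleGraph V} {D : Set V} {v : V} :
    ofSet G D v = 0 ↔ v ∉ D ∧ ∃ u, G.Adj v u ∧ u ∈ D := by
  unfold ofSet; split_ifs <;> simp_all

theorem ofSet_injective {V : Type*} (G : SimpleGraph V) : Function.Injective (ofSet G) :=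
  fun D E h => Set.ext fun v => by rw [← ofSet_eq_two (G := G), h, ofSet_eq_two]

/-- A smaller `g` vanishes at the private neighbor of `v`, and only `v` can dominate that neighbor,
so `g v = 2`. Thus `g` keeps every 2; a vertex where `g` is 0 then has a neighbor in `D` and is not
itself in `D`. -/
theorem isMinimalRDF_ofSet {V : Type*} {G : SimpleGraph V} {D : Set V} (h : HasPrivate G D) :
    IsMinimalRDF G (ofSet G D) := by
  have h0 : ∀ {a b : Fin 3}, a ≤ b → b = 0 → a = 0 := by decide
  have h2 : ∀ {a b : Fin 3}, a ≤ b → a = 2 → b = 2 := by decide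
  have h1 : ∀ {a b : Fin 3}, (b = 2 → a = 2) → (a = 0 → b = 0) → b ≤ a := by decide
  refine ⟨fun v hv => ?_, fun g hg hle v => h1 (fun hv => ?_) (fun hv => ?_)⟩
  · obtain ⟨-, u, hu, huD⟩ := ofSet_eq_zero.1 hv
    exact ⟨u, hu, ofSet_eq_two.2 huD⟩
  · have hvD := ofSet_eq_two.1 hv
    obtain ⟨u, hu, huD, hw⟩ := h v hvD
    obtain ⟨w, huw, hgw⟩ := hg u (h0 (hle u) (ofSet_eq_zero.2 ⟨huD, v, hu.symm, hvD⟩))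
    have := hw w huw (ofSet_eq_two.1 (h2 (hle w) hgw))
    exact this ▸ hgw
  · obtain ⟨u, hu, hgu⟩ := hg v hv
    have huD := ofSet_eq_two.1 (h2 (hle u) hgu)
    refine ofSet_eq_zero.2 ⟨fun hvD => ?_, u, hu, huD⟩
    obtain ⟨u', hu', huD', hw⟩ := h v hvD
    obtain ⟨w, huw, hgw⟩ := hg u' (h0 (hle u') (ofSet_eq_zero.2 ⟨huD', v, hu'.symm, hvD⟩))
    have := hw w huw (ofSet_eq_two.1 (h2 (hle w) hgw))
    subst this
    simp [hgw] at hv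

/-- Two ways of lowering a value suffice: a 1 next to a 2 could become 0, and a 2 without private
neighbor could become 1. -/
theorem IsMinimalRDF.eq_ofSet {V : Type*} {G : SimpleGraph V} {f : V → Fin 3}
    (hf : IsMinimalRDF G f) : HasPrivate G {v | f v = 2} ∧ ofSet G {v | f v = 2} = f := by
  classical
  have hred : ∀ v c, c < f v → ¬ IsRDF G (Function.update f v c) := fun v c hc hg =>
    have hle : Function.update f v c ≤ f := update_le_self_iff.2 hc.le
    absurd (hf.2 hg hle v) (by simpa using hc)
  have h1 : ∀ v, f v = 1 → ∀ u, G.Adj v u → f u ≠ 2 := fun v hv u hu hu2 => by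
    refine hred v 0 (by simp [hv]) fun w hw => ?_
    by_cases hwv : w = v
    · subst hwv; exact ⟨u, hu, by simp [hu.ne', hu2]⟩
    · rw [Function.update_of_ne hwv] at hw
      obtain ⟨t, ht, ht2⟩ := hf.1 w hw
      have : t ≠ v := by rintro rfl; simp [hv] at ht2
      exact ⟨t, ht, by simp [this, ht2]⟩
  constructor
  · intro v (hv : f v = 2)
    have := hred v 1 (by simp [hv])
    simp only [IsRDF, not_forall, not_exists, not_and] at this
    obtain ⟨u, hu, hw⟩ := this
    have huv : u ≠ v := by rintro rfl; simp at hu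
    rw [Function.update_of_ne huv] at hu
    have key : ∀ w, G.Adj u w → f w = 2 → w = v := fun w hw' h2 => by
      by_contra hne
      exact hw w hw' (by simp [hne, h2])
    obtain ⟨w, huw, h2⟩ := hf.1 u hu
    have := key w huw h2
    subst this
    exact ⟨u, huw.symm, by simp [hu], key⟩
  · funext v
    have h3 : ∀ a : Fin 3, a = 0 ∨ a = 1 ∨ a = 2 := by decide
    rcases h3 (f v) with h | h | h
    · rw [h, ofSet_eq_zero]
      exact ⟨by simp [h], hf.1 v h⟩
    · have := h1 v h
      simp only [ofSet]
      rw [if_neg (by simp [h]), if_neg (by simpa using this), h]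
    · rw [h, ofSet_eq_two]; exact h

theorem setOf_isMinimalRDF {V : Type*} (G : SimpleGraph V) :
    {f | IsMinimalRDF G f} = ofSet G '' {D | HasPrivate G D} := by
  ext f
  constructor
  · exact fun hf => ⟨_, hf.eq_ofSet⟩
  · rintro ⟨D, hD, rfl⟩; exact isMinimalRDF_ofSet hD

/-! ### The upper bound and its extremal example -/

open St Classical in
theorem ncard_isMinimalRDF_le {V : Type*} [Fintype V] {G : SimpleGraph V} (hG : G.IsAcyclic) :
    ({f : V → Fin 3 | IsMinimalRDF G f}.ncard : ℝ) ≤ √3 ^ Fintype.card V := by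
  rw [setOf_isMinimalRDF, Set.ncard_image_of_injective _ (ofSet_injective G)]
  have hle := weight_le_one hG Finset.univ (fun _ => leafWeight) (fun _ _ => Or.inl rfl) (by simp)
  set A : Finset (Set V) := Finset.univ.filter (HasPrivate G)
  have hA : {D | HasPrivate G D}.ncard = A.card := by
    rw [← Set.ncard_coe_finset]; simp [A]
  rw [hA]
  -- Before any absorption only `e` and `z` occur, and validity says that every selected vertex has
  -- a private neighbor.
  set state : Set V → V → St := fun D v => if v ∈ D then e else z with hstate
  have hinj : Function.Injective state := fun D E h => Set.ext fun v => by
    have := congrFun h v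
    simp only [hstate] at this
    by_cases h1 : v ∈ D <;> by_cases h2 : v ∈ E <;> simp_all
  have hval : ∀ D ∈ A, Valid G (state D) := fun D hD => by
    have hD : HasPrivate G D := by simpa [A] using hD
    have hs : ∀ v, state D v = e ↔ v ∈ D := fun v => by simp [hstate]
    refine ⟨fun v hv => ?_, fun v hv => ?_⟩
    · simp only [hstate] at hv; split_ifs at hv
    · obtain ⟨u, hu, huD, hw⟩ := hD v ((hs v).1 hv)
      refine ⟨u, hu, by simp [hstate, huD], fun w huw hsel => hw w huw ((hs w).1 ?_)⟩
      rcases hsel with h | h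
      · simp only [hstate] at h; split_ifs at h
      · exact h
  have hw : ∀ D, ∏ v, leafWeight (state D v) = (√3)⁻¹ ^ Fintype.card V := fun D => by
    rw [Finset.prod_eq_pow_card (b := (√3)⁻¹)]
    · rfl
    · intro v _
      simp only [hstate]; split_ifs <;> rfl
  have : (A.card : ℝ) * (√3)⁻¹ ^ Fintype.card V ≤ weight G (fun _ => leafWeight) := by
    calc (A.card : ℝ) * (√3)⁻¹ ^ Fintype.card V
        = ∑ D ∈ A, if Valid G (state D) then ∏ v, leafWeight (state D v) else 0 := by
          rw [← nsmul_eq_mul, ← Finset.sum_const]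
          refine Finset.sum_congr rfl fun D hD => ?_
          rw [if_pos (hval D hD), hw]
      _ = ∑ σ ∈ A.map ⟨state, hinj⟩, if Valid G σ then ∏ v, leafWeight (σ v) else 0 := by
          rw [Finset.sum_map]; rfl
      _ ≤ _ := by
          refine Finset.sum_le_sum_of_subset_of_nonneg (Finset.subset_univ _) fun σ _ _ => ?_
          have : 0 ≤ ∏ v, leafWeight (σ v) := Finset.prod_nonneg fun v _ => leafWeight_nonneg _
          split_ifs <;> simp [this]
  have h := this.trans hle
  rw [inv_pow, ← div_eq_mul_inv, div_le_one (by positivity)] at h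
  exact h

theorem isAcyclic_disjointP2 (m : ℕ) : (disjointP2 m).IsAcyclic := by
  intro v c hc
  have h1 := c.adj_snd hc.not_nil
  have h2 := (c.adj_penultimate hc.not_nil).symm
  -- A cycle would give its base vertex two distinct neighbors.
  apply hc.snd_ne_penultimate
  have key : ∀ a b c : Fin 2, a ≠ b → a ≠ c → b = c := by decide
  exact Prod.ext (h1.1.symm.trans h2.1) (key _ _ _ h1.2 h2.2)

theorem ncard_isMinimalRDF_disjointP2 (m : ℕ) :
    {f : Fin m × Fin 2 → Fin 3 | IsMinimalRDF (disjointP2 m) f}.ncard = 3 ^ m := by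
  rw [setOf_isMinimalRDF, Set.ncard_image_of_injective _ (ofSet_injective _)]
  have hpr : ∀ D : Set (Fin m × Fin 2), HasPrivate (disjointP2 m) D ↔
      ∀ i, (i, 0) ∈ D → (i, 1) ∉ D := fun D => by
    have h2 : ∀ a : Fin 2, a = 0 ∨ a = 1 := by decide
    constructor
    · intro h i h0 h1
      obtain ⟨⟨j, b⟩, ⟨hj, hb⟩, hD, -⟩ := h _ h0
      dsimp only at hj hb
      subst hj
      rcases h2 b with rfl | rfl <;> contradiction
    · rintro h ⟨i, b⟩ hD
      refine ⟨(i, 1 - b), ⟨rfl, ?_⟩, ?_, ?_⟩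
      · rcases h2 b with rfl | rfl <;> simp
      · rcases h2 b with rfl | rfl
        · exact h i hD
        · exact fun h0 => h i (by simpa using h0) hD
      · rintro ⟨j, b'⟩ ⟨hj, hb⟩ -
        dsimp only at hj hb
        subst hj
        rcases h2 b with rfl | rfl <;> rcases h2 b' with rfl | rfl <;> simp_all
  -- On each edge 0 selects neither end, 1 the first and 2 the second.
  set F : (Fin m → Fin 3) → Set (Fin m × Fin 2) := fun g =>
    {x | g x.1 = (if x.2 = 0 then 1 else 2)} with hF
  have hinj : Function.Injective F := fun g g' h => funext fun i => by
    have h0 := Set.ext_iff.1 h (i, 0)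
    have h1 := Set.ext_iff.1 h (i, 1)
    simp only [hF, Set.mem_ofPred_eq, if_true, one_ne_zero, if_false] at h0 h1
    generalize g i = a at *
    generalize g' i = b at *
    revert a b; decide
  have : {D | HasPrivate (disjointP2 m) D} = Set.range F := by
    classical
    ext D
    rw [Set.mem_ofPred_eq, hpr]
    constructor
    · intro h
      refine ⟨fun i => if (i, 0) ∈ D then 1 else if (i, 1) ∈ D then 2 else 0, ?_⟩
      ext ⟨i, b⟩
      have := h i
      have h2 : ∀ a : Fin 2, a = 0 ∨ a = 1 := by decide
      simp only [hF, Set.mem_ofPred_eq]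
      rcases h2 b with rfl | rfl <;> by_cases h0 : (i, 0) ∈ D <;> by_cases h1 : (i, 1) ∈ D <;>
        simp_all
    · rintro ⟨g, rfl⟩ i h0 h1
      simp_all
  rw [this, ← Set.image_univ, Set.ncard_image_of_injective _ hinj, Set.ncard_univ]
  simp

theorem sqrt_three_pow_card_disjointP2 (m : ℕ) :
    √3 ^ Fintype.card (Fin m × Fin 2) = (3 : ℝ) ^ m := by
  rw [Fintype.card_prod, Fintype.card_fin, Fintype.card_fin, mul_comm, pow_mul,
    Real.sq_sqrt (by norm_num)]

end Roman

namespace RAM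

/-! ### The program and its memory layout -/

/-- The program that enumerates minimal Roman dominating functions. Cells `0`, `1`, `10`, `11` hold
`n`, `1`, `12`, `12 + n`. The current set is stored in the cells `12 + j`, and the
cell `12 + n + j` counts the members of the set adjacent to `j`, plus `2` if `j` is a member. The
instructions `4-18` write the record of the current set, `19-28` proceed to the next candidate
in the manner of a binary counter, `29-51` compute the counts and `52-81` look for
a member without private neighbor. -/
def prog : Program :=
  [.const 1 1, .read 0 2, .const 10 12, .add 11 10 0,
   .const 3 0, .sub 7 0 3, .jumpZero 7 17, .add 7 10 3, .load 7 7, .add 8 11 3, .load 8 8,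
   .sub 8 1 8, .add 7 7 7, .add 7 7 8, .write 7, .add 3 3 1, .jump 5, .emit, .const 2 0,
   .sub 7 0 2, .jumpZero 7 82, .add 8 10 2, .load 7 8, .jumpZero 7 28,
   .const 7 0, .store 8 7, .add 2 2 1, .jump 19, .store 8 1,
   .const 5 1, .const 3 0, .sub 7 0 3, .jumpZero 7 52, .add 8 10 3, .load 6 8, .add 6 6 6,
   .const 4 0, .sub 7 0 4, .jumpZero 7 48, .read 7 5, .add 8 10 4, .load 8 8, .add 7 7 8,
   .sub 7 7 1, .add 6 6 7, .add 4 4 1, .add 5 5 1, .jump 37,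
   .add 8 11 3, .store 8 6, .add 3 3 1, .jump 31,
   .const 5 1, .const 3 0, .const 9 0, .sub 7 0 3, .jumpZero 7 80, .const 6 0, .const 4 0,
   .sub 7 0 4, .jumpZero 7 74, .add 8 11 4, .load 8 8, .sub 7 1 8, .sub 8 8 1, .sub 8 1 8,
   .sub 8 8 7, .read 7 5, .add 7 7 8, .sub 7 7 1, .add 6 6 7, .add 4 4 1, .add 5 5 1, .jump 59,
   .add 8 10 3, .load 8 8, .sub 8 8 6, .add 9 9 8, .add 3 3 1, .jump 55,
   .jumpZero 9 4, .jump 19]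

/-- The memory with given contents of the registers and arrays. -/
def enc (n : ℕ) (d C : ℕ → ℕ) (i u w p s t q b : ℕ) : ℕ →₀ ℕ :=
  Finsupp.onFinset (Finset.range (12 + 2 * n))
    (fun
      | 0 => n | 1 => 1 | 2 => i | 3 => u | 4 => w | 5 => p | 6 => s | 7 => t | 8 => q | 9 => b
      | 10 => 12 | 11 => 12 + n
      | a + 12 => if a < n then d a else if a < 2 * n then C (a - n) else 0)
    (fun a ha => by
      rw [Finset.mem_range]
      by_contra h
      obtain ⟨k, rfl⟩ : ∃ k, a = k + 12 := ⟨a - 12, by omega⟩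
      apply ha
      show (if k < n then d k else if k < 2 * n then C (k - n) else 0) = 0
      rw [if_neg (by omega), if_neg (by omega)])

section
variable (n : ℕ) (d C : ℕ → ℕ) (i u w p s t q b v : ℕ)

@[simp] theorem enc_zero : enc n d C i u w p s t q b 0 = n := rfl
@[simp] theorem enc_one : enc n d C i u w p s t q b 1 = 1 := rfl
@[simp] theorem enc_two : enc n d C i u w p s t q b 2 = i := rfl
@[simp] theorem enc_three : enc n d C i u w p s t q b 3 = u := rfl
@[simp] theorem enc_four : enc n d C i u w p s t q b 4 = w := rfl
@[simp] theorem enc_five : enc n d C i u w p s t q b 5 = p := rfl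
@[simp] theorem enc_six : enc n d C i u w p s t q b 6 = s := rfl
@[simp] theorem enc_seven : enc n d C i u w p s t q b 7 = t := rfl
@[simp] theorem enc_eight : enc n d C i u w p s t q b 8 = q := rfl
@[simp] theorem enc_nine : enc n d C i u w p s t q b 9 = b := rfl
@[simp] theorem enc_ten : enc n d C i u w p s t q b 10 = 12 := rfl
@[simp] theorem enc_eleven : enc n d C i u w p s t q b 11 = 12 + n := rfl

theorem enc_add_twelve (a : ℕ) : enc n d C i u w p s t q b (a + 12) =
    if a < n then d a else if a < 2 * n then C (a - n) else 0 := rfl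

variable {n v} in
@[simp] theorem enc_member (h : v < n) : enc n d C i u w p s t q b (12 + v) = d v := by
  rw [add_comm, enc_add_twelve, if_pos h]

variable {n v} in
@[simp] theorem enc_count (h : v < n) : enc n d C i u w p s t q b (12 + n + v) = C v := by
  rw [show 12 + n + v = (n + v) + 12 by ring, enc_add_twelve, if_neg (by omega),
    if_pos (by omega), Nat.add_sub_cancel_left]

@[simp] theorem update_enc_two :
    (enc n d C i u w p s t q b).update 2 v = enc n d C v u w p s t q b := by
  ext a
  rw [Finsupp.coe_update, Function.update_apply]
  split_ifs with h
  · subst h; rfl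
  · match a with
    | 0 | 1 | 3 | 4 | 5 | 6 | 7 | 8 | 9 | 10 | 11 | _ + 12 => rfl
    | 2 => exact absurd rfl h
@[simp] theorem update_enc_three :
    (enc n d C i u w p s t q b).update 3 v = enc n d C i v w p s t q b := by
  ext a
  rw [Finsupp.coe_update, Function.update_apply]
  split_ifs with h
  · subst h; rfl
  · match a with
    | 0 | 1 | 2 | 4 | 5 | 6 | 7 | 8 | 9 | 10 | 11 | _ + 12 => rfl
    | 3 => exact absurd rfl h
@[simp] theorem update_enc_four :
    (enc n d C i u w p s t q b).update 4 v = enc n d C i u v p s t q b := by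
  ext a
  rw [Finsupp.coe_update, Function.update_apply]
  split_ifs with h
  · subst h; rfl
  · match a with
    | 0 | 1 | 2 | 3 | 5 | 6 | 7 | 8 | 9 | 10 | 11 | _ + 12 => rfl
    | 4 => exact absurd rfl h
@[simp] theorem update_enc_five :
    (enc n d C i u w p s t q b).update 5 v = enc n d C i u w v s t q b := by
  ext a
  rw [Finsupp.coe_update, Function.update_apply]
  split_ifs with h
  · subst h; rfl
  · match a with
    | 0 | 1 | 2 | 3 | 4 | 6 | 7 | 8 | 9 | 10 | 11 | _ + 12 => rfl
    | 5 => exact absurd rfl h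
@[simp] theorem update_enc_six :
    (enc n d C i u w p s t q b).update 6 v = enc n d C i u w p v t q b := by
  ext a
  rw [Finsupp.coe_update, Function.update_apply]
  split_ifs with h
  · subst h; rfl
  · match a with
    | 0 | 1 | 2 | 3 | 4 | 5 | 7 | 8 | 9 | 10 | 11 | _ + 12 => rfl
    | 6 => exact absurd rfl h
@[simp] theorem update_enc_seven :
    (enc n d C i u w p s t q b).update 7 v = enc n d C i u w p s v q b := by
  ext a
  rw [Finsupp.coe_update, Function.update_apply]
  split_ifs with h
  · subst h; rfl
  · match a with
    | 0 | 1 | 2 | 3 | 4 | 5 | 6 | 8 | 9 | 10 | 11 | _ + 12 => rfl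
    | 7 => exact absurd rfl h
@[simp] theorem update_enc_eight :
    (enc n d C i u w p s t q b).update 8 v = enc n d C i u w p s t v b := by
  ext a
  rw [Finsupp.coe_update, Function.update_apply]
  split_ifs with h
  · subst h; rfl
  · match a with
    | 0 | 1 | 2 | 3 | 4 | 5 | 6 | 7 | 9 | 10 | 11 | _ + 12 => rfl
    | 8 => exact absurd rfl h
@[simp] theorem update_enc_nine :
    (enc n d C i u w p s t q b).update 9 v = enc n d C i u w p s t q v := by
  ext a
  rw [Finsupp.coe_update, Function.update_apply]
  split_ifs with h
  · subst h; rfl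
  · match a with
    | 0 | 1 | 2 | 3 | 4 | 5 | 6 | 7 | 8 | 10 | 11 | _ + 12 => rfl
    | 9 => exact absurd rfl h

variable {n v} in
@[simp] theorem update_enc_member (h : v < n) (c : ℕ) :
    (enc n d C i u w p s t q b).update (12 + v) c =
    enc n (Function.update d v c) C i u w p s t q b := by
  ext a
  rw [Finsupp.coe_update, Function.update_apply, add_comm 12]
  split_ifs with ha
  · subst ha; simp [enc_add_twelve, h]
  · match a with
    | 0 | 1 | 2 | 3 | 4 | 5 | 6 | 7 | 8 | 9 | 10 | 11 => rfl
    | a + 12 =>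
      have : a ≠ v := by rintro rfl; exact ha rfl
      simp [enc_add_twelve, this]

variable {n v} in
@[simp] theorem update_enc_count (h : v < n) (c : ℕ) :
    (enc n d C i u w p s t q b).update (12 + n + v) c =
      enc n d (Function.update C v c) i u w p s t q b := by
  ext a
  rw [Finsupp.coe_update, Function.update_apply, show 12 + n + v = (n + v) + 12 by ring]
  split_ifs with ha
  · subst ha
    rw [enc_add_twelve, if_neg (by omega), if_pos (by omega), Nat.add_sub_cancel_left,
      Function.update_self]
  · match a with
    | 0 | 1 | 2 | 3 | 4 | 5 | 6 | 7 | 8 | 9 | 10 | 11 => rfl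
    | a + 12 =>
      have : a < n ∨ a - n ≠ v := by
        by_contra hh
        push Not at hh
        exact ha (by omega)
      rcases this with h' | h'
      · simp [enc_add_twelve, h']
      · simp [enc_add_twelve, Function.update_of_ne h']

end

/-! ### Effect of the straight-line blocks of the program -/

section
variable {x : ℕ → ℕ} {n : ℕ} {d C : ℕ → ℕ} {i u w p s t q b : ℕ} {cur : List ℕ}
  {out : List (List ℕ)}

theorem iterate_init (hx : x 0 = n) :
    (step prog x)^[4] init = ⟨4, enc n (fun _ => 0) (fun _ => 0) 0 0 0 0 0 0 0 0, [], []⟩ := by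
  have : (((((0 : ℕ →₀ ℕ).update 1 1).update 0 n).update 10 12).update 11 (12 + n)) =
      enc n (fun _ => 0) (fun _ => 0) 0 0 0 0 0 0 0 0 := by
    ext a
    simp only [Finsupp.coe_update, Function.update_apply]
    match a with
    | 0 | 1 | 2 | 3 | 4 | 5 | 6 | 7 | 8 | 9 | 10 | 11 => rfl
    | a + 12 => simp [enc_add_twelve]
  simp [Function.iterate_succ_apply, step, prog, exec, init, hx, ← this]

theorem iterate_write_enter :
    (step prog x)^[1] ⟨4, enc n d C i u w p s t q b, cur, out⟩ =
      ⟨5, enc n d C i 0 w p s t q b, cur, out⟩ := by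
  simp [step, prog, exec]

theorem iterate_write (hu : u < n) :
    (step prog x)^[12] ⟨5, enc n d C i u w p s t q b, cur, out⟩ =
      ⟨5, enc n d C i (u + 1) w p s (d u + d u + (1 - C u)) (1 - C u) b,
        cur ++ [d u + d u + (1 - C u)], out⟩ := by
  simp [Function.iterate_succ_apply, step, prog, exec, Nat.sub_ne_zero_of_lt hu, hu]

theorem iterate_write_exit :
    (step prog x)^[4] ⟨5, enc n d C i n w p s t q b, cur, out⟩ =
      ⟨19, enc n d C 0 n w p s 0 q b, [], out ++ [cur]⟩ := by
  simp [Function.iterate_succ_apply, step, prog, exec]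

theorem iterate_halt :
    (step prog x)^[2] ⟨19, enc n d C n u w p s t q b, cur, out⟩ =
      ⟨82, enc n d C n u w p s 0 q b, cur, out⟩ := by
  simp [Function.iterate_succ_apply, step, prog, exec]

theorem iterate_clear (hi : i < n) (hd : d i ≠ 0) :
    (step prog x)^[9] ⟨19, enc n d C i u w p s t q b, cur, out⟩ =
      ⟨19, enc n (Function.update d i 0) C (i + 1) u w p s 0 (12 + i) b, cur, out⟩ := by
  simp [Function.iterate_succ_apply, step, prog, exec, Nat.sub_ne_zero_of_lt hi, hi, hd]

theorem iterate_set (hi : i < n) (hd : d i = 0) :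
    (step prog x)^[8] ⟨19, enc n d C i u w p s t q b, cur, out⟩ =
      ⟨31, enc n (Function.update d i 1) C i 0 w 1 s 0 (12 + i) b, cur, out⟩ := by
  simp [Function.iterate_succ_apply, step, prog, exec, Nat.sub_ne_zero_of_lt hi, hi, hd]

theorem iterate_count_enter (hu : u < n) :
    (step prog x)^[6] ⟨31, enc n d C i u w p s t q b, cur, out⟩ =
      ⟨37, enc n d C i u 0 p (d u + d u) (n - u) (12 + u) b, cur, out⟩ := by
  simp [Function.iterate_succ_apply, step, prog, exec, Nat.sub_ne_zero_of_lt hu, hu]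

/-- For bits, `x p + d w - 1` is their conjunction. The input pointer `p` advances by one per entry,
which avoids multiplying to locate matrix entries. -/
theorem iterate_count (hw : w < n) :
    (step prog x)^[11] ⟨37, enc n d C i u w p s t q b, cur, out⟩ =
      ⟨37, enc n d C i u (w + 1) (p + 1) (s + (x p + d w - 1)) (x p + d w - 1) (d w) b,
        cur, out⟩ := by
  simp [Function.iterate_succ_apply, step, prog, exec, Nat.sub_ne_zero_of_lt hw, hw]

theorem iterate_count_exit (hu : u < n) :
    (step prog x)^[6] ⟨37, enc n d C i u n p s t q b, cur, out⟩ =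
      ⟨31, enc n d (Function.update C u s) i (u + 1) n p s 0 (12 + n + u) b, cur, out⟩ := by
  simp [Function.iterate_succ_apply, step, prog, exec, hu]

theorem iterate_check_start :
    (step prog x)^[5] ⟨31, enc n d C i n w p s t q b, cur, out⟩ =
      ⟨55, enc n d C i 0 w 1 s 0 q 0, cur, out⟩ := by
  simp [Function.iterate_succ_apply, step, prog, exec]

theorem iterate_check_enter (hu : u < n) :
    (step prog x)^[4] ⟨55, enc n d C i u w p s t q b, cur, out⟩ =
      ⟨59, enc n d C i u 0 p 0 (n - u) q b, cur, out⟩ := by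
  simp [Function.iterate_succ_apply, step, prog, exec, Nat.sub_ne_zero_of_lt hu]

theorem iterate_check (hw : w < n) :
    (step prog x)^[15] ⟨59, enc n d C i u w p s t q b, cur, out⟩ =
      ⟨59, enc n d C i u (w + 1) (p + 1) (s + (x p + (1 - (C w - 1) - (1 - C w)) - 1))
        (x p + (1 - (C w - 1) - (1 - C w)) - 1) (1 - (C w - 1) - (1 - C w)) b, cur, out⟩ := by
  simp [Function.iterate_succ_apply, step, prog, exec, Nat.sub_ne_zero_of_lt hw, hw]

theorem iterate_check_exit (hu : u < n) :
    (step prog x)^[8] ⟨59, enc n d C i u n p s t q b, cur, out⟩ =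
      ⟨55, enc n d C i (u + 1) n p s 0 (d u - s) (b + (d u - s)), cur, out⟩ := by
  simp [Function.iterate_succ_apply, step, prog, exec, hu]

theorem iterate_accept :
    (step prog x)^[3] ⟨55, enc n d C i n w p s t q 0, cur, out⟩ =
      ⟨4, enc n d C i n w p s 0 q 0, cur, out⟩ := by
  simp [Function.iterate_succ_apply, step, prog, exec]

/-- The digit pointer `i` is not reset, so the counter next clears the element just added and
carries; this is the pruning. -/
theorem iterate_reject (hb : b ≠ 0) :
    (step prog x)^[4] ⟨55, enc n d C i n w p s t q b, cur, out⟩ =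
      ⟨19, enc n d C i n w p s 0 q b, cur, out⟩ := by
  simp [Function.iterate_succ_apply, step, prog, exec, hb]

/-! ### Space used between loop heads -/

/-- At most `N` cells are in use, and their addresses and contents are at most `M`. -/
def Within (N M : ℕ) (m : ℕ →₀ ℕ) : Prop :=
  m.support.card ≤ N ∧ ∀ a ∈ m.support, a ≤ M ∧ m a ≤ M

theorem Within.apply_le {N M : ℕ} {m : ℕ →₀ ℕ} (h : Within N M m) (a : ℕ) : m a ≤ M := by
  by_cases ha : a ∈ m.support
  · exact (h.2 a ha).2
  · rw [Finsupp.notMem_support_iff.1 ha]; exact Nat.zero_le _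

theorem Within.mono {N M N' M' : ℕ} {m : ℕ →₀ ℕ} (h : Within N M m) (hN : N ≤ N') (hM : M ≤ M') :
    Within N' M' m :=
  ⟨h.1.trans hN, fun a ha => ⟨(h.2 a ha).1.trans hM, (h.2 a ha).2.trans hM⟩⟩

theorem Within.update {N M a v M' : ℕ} {m : ℕ →₀ ℕ} (h : Within N M m) (hM : M ≤ M') (ha : a ≤ M')
    (hv : v ≤ M') : Within (N + 1) M' (m.update a v) := by
  classical
  have hs : (m.update a v).support ⊆ insert a m.support := fun k hk => by
    rw [Finsupp.mem_support_iff, Finsupp.coe_update, Function.update_apply] at hk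
    rw [Finset.mem_insert, Finsupp.mem_support_iff]
    split_ifs at hk with h1
    · exact Or.inl h1
    · exact Or.inr hk
  refine ⟨(Finset.card_le_card hs).trans ((Finset.card_insert_le _ _).trans
    (Nat.add_le_add_right h.1 1)), fun k hk => ⟨?_, ?_⟩⟩
  · rcases Finset.mem_insert.1 (hs hk) with rfl | h1
    · exact ha
    · exact (h.2 k h1).1.trans hM
  · rw [Finsupp.coe_update, Function.update_apply]
    split_ifs
    · exact hv
    · exact (h.apply_le k).trans hM

theorem Within.space_le {N M : ℕ} {m : ℕ →₀ ℕ} (h : Within N M m) : space m ≤ N * (2 * M) := by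
  have hsize : ∀ a, Nat.size a ≤ a := fun a => Nat.size_le.2 Nat.lt_two_pow_self
  calc space m ≤ ∑ _a ∈ m.support, 2 * M := Finset.sum_le_sum fun a ha => by
        have := h.2 a ha
        have := hsize a
        have := hsize (m a)
        omega
    _ = m.support.card * (2 * M) := by rw [Finset.sum_const, smul_eq_mul]
    _ ≤ N * (2 * M) := Nat.mul_le_mul_right _ h.1

/-- The constants and the addresses of the results in an instruction are at most `12`. -/
def Instr.IsSmall : Instr → Prop
  | .const a c => a ≤ 12 ∧ c ≤ 12
  | .add a _ _ | .sub a _ _ | .load a _ | .read a _ => a ≤ 12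
  | _ => True

theorem isSmall_of_mem_prog : ∀ i ∈ prog, i.IsSmall := by
  simp [prog, Instr.IsSmall]

/-- One step touches at most one new cell and at most doubles the largest content. An indirect store
uses a content as an address, so one bound serves for both. -/
theorem Within.step {N M K : ℕ} {c : Config} (h : Within N M c.mem) (hx : ∀ k, x k ≤ K) :
    Within (N + 1) (2 * M + (K + 12)) (RAM.step prog x c).mem := by
  have h0 := h.mono (Nat.le_succ N) (show M ≤ 2 * M + (K + 12) by omega)
  have hm := h.apply_le
  unfold RAM.step
  split
  · exact h0
  · rename_i i hi
    have hs := isSmall_of_mem_prog i (List.mem_of_getElem? hi)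
    cases i with
    | const a c => exact h.update (by omega) (by have := hs.1; omega) (by have := hs.2; omega)
    | add a b c =>
      have hs : a ≤ 12 := hs
      have := hm b; have := hm c
      exact h.update (by omega) (by omega) (by omega)
    | sub a b c =>
      have hs : a ≤ 12 := hs
      have := hm b; have := hm c
      exact h.update (by omega) (by omega) (by omega)
    | load a b =>
      have hs : a ≤ 12 := hs
      have := hm (c.mem b)
      exact h.update (by omega) (by omega) (by omega)
    | store a b =>
      have := hm a; have := hm b
      exact h.update (by omega) (by omega) (by omega)
    | read a b =>
      have hs : a ≤ 12 := hs
      have := hx (c.mem b)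
      exact h.update (by omega) (by omega) (by omega)
    | jump l => exact h0
    | jumpZero a l => exact h0
    | write a => exact h0
    | emit => exact h0

theorem Within.iterate {N M K : ℕ} {c : Config} (h : Within N M c.mem) (hx : ∀ k, x k ≤ K)
    (r : ℕ) : ∃ M', M' + (K + 12) ≤ 2 ^ r * (M + (K + 12)) ∧
      Within (N + r) M' ((RAM.step prog x)^[r] c).mem := by
  induction r with
  | zero => exact ⟨M, by simp, h⟩
  | succ r ih =>
    obtain ⟨M', hM', hW⟩ := ih
    refine ⟨2 * M' + (K + 12), by rw [pow_succ]; linarith, ?_⟩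
    rw [Function.iterate_succ_apply']
    exact hW.step hx

/-- A bound for the contents of the memory at the heads of the loops. -/
def cellBound (n : ℕ) : ℕ := n * n + 3 * n + 20

/-- A bound for the space that the machine uses. -/
def spaceBound (n : ℕ) : ℕ :=
  (12 + 2 * n + 20) * (2 * (2 ^ 20 * (cellBound n + (n + 1 + 12))))

theorem within_enc (hd : ∀ j, d j ≤ 1) (hC : ∀ j, C j ≤ n + 2) (hi : i ≤ n) (hu : u ≤ n)
    (hw : w ≤ n) (hp : p ≤ n * n + 1) (hs : s ≤ n + 2) (ht : t ≤ 2 * n + 12) (hq : q ≤ 2 * n + 12)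
    (hb : b ≤ n) : Within (12 + 2 * n) (cellBound n) (enc n d C i u w p s t q b) := by
  unfold cellBound
  refine ⟨(Finset.card_le_card Finsupp.support_onFinset_subset).trans (by simp), fun a ha => ?_⟩
  have ha := Finset.mem_range.1 (Finsupp.support_onFinset_subset ha)
  refine ⟨by omega, ?_⟩
  match a with
  | 0 | 1 | 2 | 3 | 4 | 5 | 6 | 7 | 8 | 9 | 10 | 11 => simp <;> omega
  | a + 12 =>
    rw [enc_add_twelve]
    have := hd a
    have := hC (a - n)
    split_ifs <;> omega

/-- The machine gets from `c` to `c'` in at most `k` steps without finishing a record and without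
using too much space. -/
def Reach (x : ℕ → ℕ) (n k : ℕ) (c c' : Config) : Prop :=
  ∃ j ≤ k, (step prog x)^[j] c = c' ∧ c'.out = c.out ∧
    ∀ r ≤ j, space ((step prog x)^[r] c).mem ≤ spaceBound n

theorem Reach.trans {k k' : ℕ} {c c' c'' : Config} (h : Reach x n k c c')
    (h' : Reach x n k' c' c'') : Reach x n (k + k') c c'' := by
  obtain ⟨j, hj, rfl, ho, hs⟩ := h
  obtain ⟨j', hj', rfl, ho', hs'⟩ := h'
  refine ⟨j' + j, by omega, by rw [Function.iterate_add_apply], ho'.trans ho, fun r hr => ?_⟩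
  by_cases h : r ≤ j
  · exact hs r h
  · obtain ⟨r', rfl⟩ : ∃ r', r = r' + j := ⟨r - j, by omega⟩
    rw [Function.iterate_add_apply]
    exact hs' r' (by omega)

theorem Reach.mono {k k' : ℕ} {c c' : Config} (h : Reach x n k c c') (hk : k ≤ k') :
    Reach x n k' c c' := by
  obtain ⟨j, hj, h⟩ := h
  exact ⟨j, hj.trans hk, h⟩

/-- The first cell of the input is `n` and all others are `0` or `1`. -/
def IsInput (x : ℕ → ℕ) (n : ℕ) : Prop := x 0 = n ∧ ∀ k, k ≠ 0 → x k ≤ 1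

theorem IsInput.le (hx : IsInput x n) (k : ℕ) : x k ≤ n + 1 := by
  by_cases h : k = 0
  · rw [h, hx.1]; omega
  · exact (hx.2 k h).trans (by omega)

/-- Blocks are short, so doubling at every step costs only the constant factor `2 ^ 20`; no
individual intermediate memory needs to be described. -/
theorem space_iterate_le {c : Config} (hx : IsInput x n)
    (hc : Within (12 + 2 * n) (cellBound n) c.mem) {r : ℕ} (hr : r ≤ 20) :
    space ((step prog x)^[r] c).mem ≤ spaceBound n := by
  obtain ⟨M', hM', hW⟩ := hc.iterate hx.le r
  refine hW.space_le.trans (Nat.mul_le_mul (by omega) (Nat.mul_le_mul_left _ ?_))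
  have : 2 ^ r * (cellBound n + (n + 1 + 12)) ≤ 2 ^ 20 * (cellBound n + (n + 1 + 12)) :=
    Nat.mul_le_mul_right _ (Nat.pow_le_pow_right (by norm_num) hr)
  omega

theorem reach_of_iterate {k : ℕ} {c c' : Config} (hx : IsInput x n)
    (h : (step prog x)^[k] c = c') (hc : Within (12 + 2 * n) (cellBound n) c.mem)
    (ho : c'.out = c.out := by rfl) (hk : k ≤ 20 := by norm_num) :
    Reach x n k c c' :=
  ⟨k, le_rfl, h, ho, fun _ hr => space_iterate_le hx hc (hr.trans hk)⟩

/-! ### The loops that write, count and check -/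

/-- The entry `v` of the record of the set with indicator function `d` and counts `C`. -/
def outVal (d C : ℕ → ℕ) (v : ℕ) : ℕ := d v + d v + (1 - C v)

theorem Reach.refl {c : Config} (hx : IsInput x n)
    (hc : Within (12 + 2 * n) (cellBound n) c.mem) : Reach x n 0 c c :=
  reach_of_iterate hx rfl hc

theorem reach_write (hx : IsInput x n) (hd : ∀ j, d j ≤ 1) (hC : ∀ j, C j ≤ n + 2) (hi : i ≤ n)
    (hw : w ≤ n) (hp : p ≤ n * n + 1) (hs : s ≤ n + 2) (hb : b ≤ n) (k : ℕ) :
    ∀ (u t q : ℕ) (cur : List ℕ), u + k = n → t ≤ 2 * n + 12 → q ≤ 2 * n + 12 →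
    ∃ t' q', t' ≤ 2 * n + 12 ∧ q' ≤ 2 * n + 12 ∧
      Reach x n (12 * k) ⟨5, enc n d C i u w p s t q b, cur, out⟩
        ⟨5, enc n d C i n w p s t' q' b, cur ++ (List.range' u k).map (outVal d C), out⟩ := by
  induction k with
  | zero =>
    intro u t q cur hu ht hq
    obtain rfl : u = n := hu
    refine ⟨t, q, ht, hq, ?_⟩
    simpa using Reach.refl hx (within_enc hd hC hi le_rfl hw hp hs ht hq hb)
  | succ k ih =>
    intro u t q cur hu ht hq
    have hdu := hd u
    obtain ⟨t', q', ht', hq', h⟩ := ih (u + 1) (outVal d C u) (1 - C u) (cur ++ [outVal d C u])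
      (by omega) (by unfold outVal; omega) (by omega)
    refine ⟨t', q', ht', hq', ?_⟩
    have h0 := reach_of_iterate (c := ⟨5, enc n d C i u w p s t q b, cur, out⟩) hx
      (iterate_write (by omega)) (within_enc hd hC hi (by omega) hw hp hs ht hq hb)
    have h2 := (h0.trans h).mono (show 12 + 12 * k ≤ 12 * (k + 1) by omega)
    rw [List.range'_succ, List.map_cons, List.append_cons]
    exact h2

/-- The number of neighbors of `u` in the set with indicator function `d`, plus `2` if `u` belongs
to it. -/
def count (x : ℕ → ℕ) (n : ℕ) (d : ℕ → ℕ) (u : ℕ) : ℕ :=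
  d u + d u + ∑ k ∈ Finset.range n, (x (1 + u * n + k) + d k - 1)

/-- The indicator of the number `1`. -/
def isOne (c : ℕ) : ℕ := 1 - (c - 1) - (1 - c)

/-- The number of neighbors of `v` whose count is `1`. -/
def privates (x : ℕ → ℕ) (n : ℕ) (C : ℕ → ℕ) (v : ℕ) : ℕ :=
  ∑ k ∈ Finset.range n, (x (1 + v * n + k) + isOne (C k) - 1)

theorem isOne_le (c : ℕ) : isOne c ≤ 1 := by unfold isOne; omega

theorem row_le {n u : ℕ} (hu : u < n) : 1 + u * n + n ≤ n * n + 1 := by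
  have := Nat.mul_le_mul_right n (show u + 1 ≤ n from hu)
  rw [add_mul] at this
  omega

/-- The accumulator `s` grows by at most 1 per column, so `s + k ≤ n + 2` is an invariant. Of the
scratch registers only the size is tracked. -/
theorem reach_count_row (hx : IsInput x n) (hd : ∀ j, d j ≤ 1) (hC : ∀ j, C j ≤ n + 2) (hi : i ≤ n)
    (hu : u < n) (hb : b ≤ n) (k : ℕ) :
    ∀ (w s t q : ℕ), w + k = n → s + k ≤ n + 2 → t ≤ 2 * n + 12 → q ≤ 2 * n + 12 →
    ∃ t' q', t' ≤ 2 * n + 12 ∧ q' ≤ 2 * n + 12 ∧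
      Reach x n (11 * k) ⟨37, enc n d C i u w (1 + u * n + w) s t q b, cur, out⟩
        ⟨37, enc n d C i u n (1 + u * n + n)
          (s + ∑ k ∈ Finset.Ico w n, (x (1 + u * n + k) + d k - 1)) t' q' b, cur, out⟩ := by
  have hun := row_le hu
  induction k with
  | zero =>
    intro w s t q hw hs ht hq
    obtain rfl : w = n := hw
    refine ⟨t, q, ht, hq, ?_⟩
    simp only [Finset.Ico_self, Finset.sum_empty, add_zero]
    exact Reach.refl hx
      (within_enc hd hC hi hu.le le_rfl hun (by omega) ht hq hb)
  | succ k ih =>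
    intro w s t q hw hs ht hq
    have h1 := hd w
    have h2 := hx.2 (1 + u * n + w) (by omega)
    obtain ⟨t', q', ht', hq', h⟩ := ih (w + 1) (s + (x (1 + u * n + w) + d w - 1))
      (x (1 + u * n + w) + d w - 1) (d w) (by omega) (by omega) (by omega) (by omega)
    refine ⟨t', q', ht', hq', ?_⟩
    have h0 := reach_of_iterate (c := ⟨37, enc n d C i u w (1 + u * n + w) s t q b, cur, out⟩) hx
      (iterate_count (by omega))
      (within_enc hd hC hi hu.le (by omega) (by omega) (by omega) ht hq hb)
    rw [Finset.sum_eq_sum_Ico_succ_bot (by omega), ← add_assoc s]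
    exact (h0.trans h).mono (by omega)

theorem count_le (hx : IsInput x n) (hd : ∀ j, d j ≤ 1) (u : ℕ) : count x n d u ≤ n + 2 := by
  have : ∑ k ∈ Finset.range n, (x (1 + u * n + k) + d k - 1) ≤ ∑ k ∈ Finset.range n, 1 :=
    Finset.sum_le_sum fun k _ => by
      have := hx.2 (1 + u * n + k) (by omega)
      have := hd k
      omega
  have h := hd u
  simp only [Finset.sum_const, Finset.card_range, smul_eq_mul, mul_one] at this
  unfold count
  omega

/-- The array may start with stale counts. That entries below `u` survive is what lets the induction
keep the rows already computed. -/
theorem reach_count (hx : IsInput x n) (hd : ∀ j, d j ≤ 1) (hi : i ≤ n) (hb : b ≤ n) (k : ℕ) :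
    ∀ (u w s t q : ℕ) (C : ℕ → ℕ), u + k = n → (∀ j, C j ≤ n + 2) → w ≤ n → s ≤ n + 2 →
      t ≤ 2 * n + 12 → q ≤ 2 * n + 12 →
    ∃ C' w' s' t' q', (∀ j, C' j ≤ n + 2) ∧ (∀ j < u, C' j = C j) ∧
      (∀ j, u ≤ j → j < n → C' j = count x n d j) ∧ w' ≤ n ∧ s' ≤ n + 2 ∧
      t' ≤ 2 * n + 12 ∧ q' ≤ 2 * n + 12 ∧
      Reach x n ((11 * n + 12) * k) ⟨31, enc n d C i u w (1 + u * n) s t q b, cur, out⟩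
        ⟨31, enc n d C' i n w' (1 + n * n) s' t' q' b, cur, out⟩ := by
  induction k with
  | zero =>
    intro u w s t q C hu hC hw hs ht hq
    obtain rfl : u = n := hu
    exact ⟨C, w, s, t, q, hC, fun _ _ => rfl, fun j h1 h2 => absurd h2 (by omega), hw, hs, ht, hq,
      Reach.refl hx (within_enc hd hC hi le_rfl hw (by omega) hs ht hq hb)⟩
  | succ k ih =>
    intro u w s t q C hu hC hw hs ht hq
    have hun : u < n := by omega
    have hrow := row_le hun
    have h1 := hd u
    have r0 := reach_of_iterate (c := ⟨31, enc n d C i u w (1 + u * n) s t q b, cur, out⟩) hx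
      (iterate_count_enter hun) (within_enc hd hC hi hun.le hw (by omega) hs ht hq hb)
    obtain ⟨t', q', ht', hq', r1⟩ := reach_count_row (cur := cur) (out := out) hx hd hC hi hun hb n
      0 (d u + d u) (n - u) (12 + u) (by omega) (by omega) (by omega) (by omega)
    rw [← Finset.range_eq_Ico] at r1
    change Reach x n (11 * n) _ ⟨37, enc n d C i u n (1 + u * n + n) (count x n d u) t' q' b, _, _⟩
      at r1
    have hcle := count_le hx hd u
    have r2 := reach_of_iterate (c := ⟨37, enc n d C i u n (1 + u * n + n) (count x n d u) t' q' b,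
      cur, out⟩) hx (iterate_count_exit hun)
      (within_enc hd hC hi hun.le le_rfl hrow hcle ht' hq' hb)
    have hC2 : ∀ j, Function.update C u (count x n d u) j ≤ n + 2 := fun j => by
      rw [Function.update_apply]; split_ifs; exacts [hcle, hC j]
    obtain ⟨C', w', s', t'', q'', hC', hlt, hge, hw', hs', ht'', hq'', r3⟩ :=
      ih (u + 1) n (count x n d u) 0 (12 + n + u) _ (by omega) hC2 le_rfl hcle (by omega) (by omega)
    refine ⟨C', w', s', t'', q'', hC', fun j hj => ?_, fun j hj hjn => ?_, hw', hs', ht'', hq'', ?_⟩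
    · rw [hlt j (by omega), Function.update_of_ne (by omega)]
    · rcases hj.eq_or_lt with rfl | hj
      · rw [hlt u (by omega), Function.update_self]
      · exact hge j hj hjn
    · rw [show 1 + (u + 1) * n = 1 + u * n + n by ring] at r3
      exact (((r0.trans r1).trans r2).trans r3).mono (by rw [Nat.mul_succ]; omega)

theorem reach_check_row (hx : IsInput x n) (hd : ∀ j, d j ≤ 1) (hC : ∀ j, C j ≤ n + 2) (hi : i ≤ n)
    (hu : u < n) (hb : b ≤ n) (k : ℕ) :
    ∀ (w s t q : ℕ), w + k = n → s + k ≤ n + 2 → t ≤ 2 * n + 12 → q ≤ 2 * n + 12 →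
    ∃ t' q', t' ≤ 2 * n + 12 ∧ q' ≤ 2 * n + 12 ∧
      Reach x n (15 * k) ⟨59, enc n d C i u w (1 + u * n + w) s t q b, cur, out⟩
        ⟨59, enc n d C i u n (1 + u * n + n)
          (s + ∑ k ∈ Finset.Ico w n, (x (1 + u * n + k) + isOne (C k) - 1)) t' q' b,
          cur, out⟩ := by
  have hun := row_le hu
  induction k with
  | zero =>
    intro w s t q hw hs ht hq
    obtain rfl : w = n := hw
    refine ⟨t, q, ht, hq, ?_⟩
    simp only [Finset.Ico_self, Finset.sum_empty, add_zero]
    exact Reach.refl hx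
      (within_enc hd hC hi hu.le le_rfl hun (by omega) ht hq hb)
  | succ k ih =>
    intro w s t q hw hs ht hq
    have h1 := isOne_le (C w)
    have h2 := hx.2 (1 + u * n + w) (by omega)
    obtain ⟨t', q', ht', hq', h⟩ := ih (w + 1) (s + (x (1 + u * n + w) + isOne (C w) - 1))
      (x (1 + u * n + w) + isOne (C w) - 1) (isOne (C w)) (by omega) (by omega) (by omega)
      (by omega)
    refine ⟨t', q', ht', hq', ?_⟩
    have h0 := reach_of_iterate (c := ⟨59, enc n d C i u w (1 + u * n + w) s t q b, cur, out⟩) hx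
      (iterate_check (by omega))
      (within_enc hd hC hi hu.le (by omega) (by omega) (by omega) ht hq hb)
    rw [Finset.sum_eq_sum_Ico_succ_bot (by omega), ← add_assoc s]
    exact (h0.trans h).mono (by omega)

theorem privates_le (hx : IsInput x n) (u : ℕ) : privates x n C u ≤ n := by
  have : ∑ k ∈ Finset.range n, (x (1 + u * n + k) + isOne (C k) - 1) ≤ ∑ k ∈ Finset.range n, 1 :=
    Finset.sum_le_sum fun k _ => by
      have := hx.2 (1 + u * n + k) (by omega)
      have := isOne_le (C k)
      omega
  simpa [privates] using this

theorem reach_check (hx : IsInput x n) (hd : ∀ j, d j ≤ 1) (hC : ∀ j, C j ≤ n + 2) (hi : i ≤ n)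
    (k : ℕ) :
    ∀ (u w s t q b : ℕ), u + k = n → b + k ≤ n → w ≤ n → s ≤ n + 2 →
      t ≤ 2 * n + 12 → q ≤ 2 * n + 12 →
    ∃ w' s' t' q', w' ≤ n ∧ s' ≤ n + 2 ∧ t' ≤ 2 * n + 12 ∧ q' ≤ 2 * n + 12 ∧
      b + ∑ v ∈ Finset.Ico u n, (d v - privates x n C v) ≤ n ∧
      Reach x n ((15 * n + 12) * k) ⟨55, enc n d C i u w (1 + u * n) s t q b, cur, out⟩
        ⟨55, enc n d C i n w' (1 + n * n) s' t' q'
          (b + ∑ v ∈ Finset.Ico u n, (d v - privates x n C v)), cur, out⟩ := by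
  induction k with
  | zero =>
    intro u w s t q b hu hb hw hs ht hq
    obtain rfl : u = n := hu
    refine ⟨w, s, t, q, hw, hs, ht, hq, by simpa using hb, ?_⟩
    simp only [Finset.Ico_self, Finset.sum_empty, add_zero]
    exact Reach.refl hx
      (within_enc hd hC hi le_rfl hw (by omega) hs ht hq (by omega))
  | succ k ih =>
    intro u w s t q b hu hb hw hs ht hq
    have hun : u < n := by omega
    have hrow := row_le hun
    have h1 := hd u
    have r0 := reach_of_iterate (c := ⟨55, enc n d C i u w (1 + u * n) s t q b, cur, out⟩) hx
      (iterate_check_enter hun) (within_enc hd hC hi hun.le hw (by omega) hs ht hq (by omega))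
    obtain ⟨t', q', ht', hq', r1⟩ := reach_check_row (b := b) (cur := cur) (out := out) hx hd hC hi
      hun (by omega) n 0 0 (n - u) q (by omega) (by omega) (by omega) (by omega)
    rw [← Finset.range_eq_Ico, zero_add] at r1
    change Reach x n (15 * n) _
      ⟨59, enc n d C i u n (1 + u * n + n) (privates x n C u) t' q' b, _, _⟩ at r1
    have hple := privates_le (C := C) hx u
    have r2 := reach_of_iterate (c := ⟨59, enc n d C i u n (1 + u * n + n) (privates x n C u) t' q'
      b, cur, out⟩) hx (iterate_check_exit hun)
      (within_enc hd hC hi hun.le le_rfl hrow (by omega) ht' hq' (by omega))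
    obtain ⟨w', s', t'', q'', hw', hs', ht'', hq'', hle, r3⟩ :=
      ih (u + 1) n (privates x n C u) 0 (d u - privates x n C u) (b + (d u - privates x n C u))
        (by omega) (by omega) le_rfl (by omega) (by omega) (by omega)
    rw [Finset.sum_eq_sum_Ico_succ_bot hun, ← add_assoc b]
    refine ⟨w', s', t'', q'', hw', hs', ht'', hq'', hle, ?_⟩
    rw [show 1 + (u + 1) * n = 1 + u * n + n by ring] at r3
    exact (((r0.trans r1).trans r2).trans r3).mono (by rw [Nat.mul_succ]; omega)

end

/-! ### The backtracking search and its delay -/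

section
variable {x : ℕ → ℕ} {n : ℕ}

/-- The indicator function of a set. -/
def indic (D : Finset ℕ) (j : ℕ) : ℕ := if j ∈ D then 1 else 0

theorem indic_le (D : Finset ℕ) (j : ℕ) : indic D j ≤ 1 := by
  unfold indic; split_ifs <;> omega

theorem update_indic_insert (D : Finset ℕ) (i : ℕ) :
    Function.update (indic D) i 1 = indic (insert i D) := by
  funext j
  rw [Function.update_apply]
  by_cases h : j = i <;> simp [indic, h]

theorem update_indic_erase (D : Finset ℕ) (i : ℕ) :
    Function.update (indic D) i 0 = indic (D.erase i) := by
  funext j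
  rw [Function.update_apply]
  by_cases h : j = i <;> simp [indic, h]

/-- The test of the program for the existence of private neighbors. -/
def Feasible (x : ℕ → ℕ) (n : ℕ) (D : Finset ℕ) : Prop :=
  ∀ v < n, v ∈ D → privates x n (count x n (indic D)) v ≠ 0

/-- The record that the program writes for the set `D`. -/
def setRecord (x : ℕ → ℕ) (n : ℕ) (D : Finset ℕ) : List ℕ :=
  (List.range' 0 n).map (outVal (indic D) (count x n (indic D)))

/-- The machine is about to write the record of `D`. -/
def AtOut (x : ℕ → ℕ) (n : ℕ) (D : Finset ℕ) (c : Config) : Prop :=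
  ∃ C i u w p s t q b, (∀ j, C j ≤ n + 2) ∧ (∀ j < n, C j = count x n (indic D) j) ∧ i ≤ n ∧ u ≤ n ∧
    w ≤ n ∧ p ≤ n * n + 1 ∧ s ≤ n + 2 ∧ t ≤ 2 * n + 12 ∧ q ≤ 2 * n + 12 ∧ b ≤ n ∧
    c = ⟨4, enc n (indic D) C i u w p s t q b, [], c.out⟩

/-- The machine is about to increase the digit `i` of the set `D`. -/
def AtCarry (n : ℕ) (D : Finset ℕ) (i : ℕ) (c : Config) : Prop :=
  ∃ C u w p s t q b, (∀ j, C j ≤ n + 2) ∧ u ≤ n ∧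
    w ≤ n ∧ p ≤ n * n + 1 ∧ s ≤ n + 2 ∧ t ≤ 2 * n + 12 ∧ q ≤ 2 * n + 12 ∧ b ≤ n ∧
    c = ⟨19, enc n (indic D) C i u w p s t q b, [], c.out⟩

/-- The machine gets from `c` to `c'` in at most `k` steps in which it finishes the record `r`,
without using too much space. -/
def Emits (x : ℕ → ℕ) (n k : ℕ) (r : List ℕ) (c c' : Config) : Prop :=
  ∃ j ≤ k, (step prog x)^[j] c = c' ∧ c'.out = c.out ++ [r] ∧
    ∀ r ≤ j, space ((step prog x)^[r] c).mem ≤ spaceBound n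

theorem AtOut.emits (hx : IsInput x n) {D : Finset ℕ} {c : Config} (h : AtOut x n D c) :
    ∃ c', Emits x n (12 * n + 5) (setRecord x n D) c c' ∧ AtCarry n D 0 c' := by
  obtain ⟨C, i, u, w, p, s, t, q, b, hC, hCn, hi, hu, hw, hp, hs, ht, hq, hb, hc⟩ := h
  have hd := indic_le D
  generalize c.out = out at hc
  subst hc
  have r0 := reach_of_iterate hx (iterate_write_enter (cur := []) (out := out))
    (within_enc hd hC hi hu hw hp hs ht hq hb)
  obtain ⟨t', q', ht', hq', r1⟩ := reach_write (out := out) hx hd hC hi hw hp hs hb n 0 t q []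
    (by omega) ht hq
  obtain ⟨j, hj, hit, -, hsp⟩ := r0.trans r1
  have hrec : (List.range' 0 n).map (outVal (indic D) C) = setRecord x n D := by
    refine List.map_congr_left fun v hv => ?_
    rw [List.mem_range'] at hv
    obtain ⟨k, hk, rfl⟩ := hv
    unfold outVal
    rw [hCn _ (by omega)]
  rw [List.nil_append, hrec] at hit
  have hW := within_enc hd hC hi le_rfl hw hp hs ht' hq' hb
  have hlast := iterate_write_exit (x := x) (n := n) (d := indic D) (C := C) (i := i) (w := w)
    (p := p) (s := s) (t := t') (q := q') (b := b) (cur := setRecord x n D) (out := out)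
  refine ⟨⟨19, enc n (indic D) C 0 n w p s 0 q' b, [], out ++ [setRecord x n D]⟩,
    ⟨4 + j, by omega, ?_, ?_, fun r hr => ?_⟩, C, n, w, p, s, 0, q', b, hC, le_rfl, hw,
    hp, hs, by omega, hq', hb, rfl⟩
  · rw [Function.iterate_add_apply, hit, hlast]
  · rfl
  · by_cases h : r ≤ j
    · exact hsp r h
    · obtain ⟨r', rfl⟩ : ∃ r', r = r' + j := ⟨r - j, by omega⟩
      rw [Function.iterate_add_apply, hit]
      exact space_iterate_le hx hW (by omega)

theorem AtCarry.halts (hx : IsInput x n) {D : Finset ℕ} {c : Config} (h : AtCarry n D n c) :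
    ∃ c', Reach x n 2 c c' ∧ Halted prog c' ∧ c'.cur = [] := by
  obtain ⟨C, u, w, p, s, t, q, b, hC, hu, hw, hp, hs, ht, hq, hb, hc⟩ := h
  generalize c.out = out at hc
  subst hc
  exact ⟨_, reach_of_iterate hx (iterate_halt (cur := []) (out := out))
    (within_enc (indic_le D) hC le_rfl hu hw hp hs ht hq hb), le_rfl, rfl⟩

theorem AtCarry.clear (hx : IsInput x n) {D : Finset ℕ} {i : ℕ} {c : Config} (h : AtCarry n D i c)
    (hi : i < n) (hD : i ∈ D) : ∃ c', Reach x n 9 c c' ∧ AtCarry n (D.erase i) (i + 1) c' := by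
  obtain ⟨C, u, w, p, s, t, q, b, hC, hu, hw, hp, hs, ht, hq, hb, hc⟩ := h
  generalize c.out = out at hc
  subst hc
  refine ⟨_, reach_of_iterate hx (iterate_clear (cur := []) (out := out) hi (by simp [indic, hD]))
    (within_enc (indic_le D) hC hi.le hu hw hp hs ht hq hb), C, u, w, p, s, 0, 12 + i, b, hC,
    hu, hw, hp, hs, by omega, by omega, hb, ?_⟩
  rw [update_indic_erase]

theorem privates_congr {C C' : ℕ → ℕ} (h : ∀ j < n, C j = C' j) (v : ℕ) :
    privates x n C v = privates x n C' v :=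
  Finset.sum_congr rfl fun k hk => by rw [h k (Finset.mem_range.1 hk)]

theorem feasible_iff_sum {D : Finset ℕ} {C : ℕ → ℕ} (h : ∀ j < n, C j = count x n (indic D) j) :
    Feasible x n D ↔ ∑ v ∈ Finset.range n, (indic D v - privates x n C v) = 0 := by
  rw [Finset.sum_eq_zero_iff]
  refine forall_congr' fun v => ?_
  rw [Finset.mem_range, privates_congr h]
  refine imp_congr_right fun hv => ?_
  by_cases hD : v ∈ D
  · simp [indic, hD]; omega
  · simp [indic, hD]

/-- A bound for the time that passes between the test of a set and the test of its predecessor. -/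
def testTime (n : ℕ) : ℕ := 8 + (11 * n + 12) * n + 5 + (15 * n + 12) * n + 4

theorem AtCarry.test (hx : IsInput x n) {D : Finset ℕ} {i : ℕ} {c : Config} (h : AtCarry n D i c)
    (hi : i < n) (hD : i ∉ D) : ∃ c', Reach x n (testTime n) c c' ∧
      ((Feasible x n (insert i D) ∧ AtOut x n (insert i D) c') ∨
        (¬ Feasible x n (insert i D) ∧ AtCarry n (insert i D) i c')) := by
  obtain ⟨C, u, w, p, s, t, q, b, hC, hu, hw, hp, hs, ht, hq, hb, hc⟩ := h
  generalize c.out = out at hc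
  subst hc
  have hd := indic_le (insert i D)
  have r0 := reach_of_iterate hx (iterate_set (cur := []) (out := out) hi (by simp [indic, hD]))
    (within_enc (indic_le D) hC hi.le hu hw hp hs ht hq hb)
  rw [update_indic_insert] at r0
  obtain ⟨C', w', s', t', q', hC', -, hcount, hw', hs', ht', hq', r1⟩ := reach_count (cur := [])
    (out := out) hx hd hi.le hb n 0 w s 0 (12 + i) C (by omega) hC hw hs (by omega) (by omega)
  rw [zero_mul, add_zero] at r1
  have r2 := reach_of_iterate hx (iterate_check_start (cur := []) (out := out))
    (within_enc hd hC' hi.le le_rfl hw' (add_comm 1 (n * n)).le hs' ht' hq' hb)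
  obtain ⟨w2, s2, t2, q2, hw2, hs2, ht2, hq2, hb2, r3⟩ := reach_check (cur := [])
    (out := out) hx hd hC' hi.le n 0 w' s' 0 q' 0 (by omega) (by omega) hw' hs' (by omega) hq'
  rw [zero_mul, add_zero, ← Finset.range_eq_Ico, zero_add] at r3
  rw [← Finset.range_eq_Ico, zero_add] at hb2
  have hcn : ∀ j < n, C' j = count x n (indic (insert i D)) j := fun j hj =>
    hcount j (Nat.zero_le _) hj
  have hfe := feasible_iff_sum hcn
  have r4 := ((r0.trans r1).trans r2).trans r3
  generalize ∑ v ∈ Finset.range n, (indic (insert i D) v - privates x n C' v) = b' at *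
  by_cases hb' : b' = 0
  · subst hb'
    have r5 := reach_of_iterate hx (iterate_accept (cur := []) (out := out))
      (within_enc hd hC' hi.le le_rfl hw2 (add_comm 1 (n * n)).le hs2 ht2 hq2 hb2)
    exact ⟨_, (r4.trans r5).mono (by unfold testTime; omega), Or.inl ⟨hfe.2 rfl, C', i, n, w2, _,
      s2, 0, q2, 0, hC', hcn, hi.le, le_rfl, hw2, (add_comm 1 (n * n)).le, hs2, by omega, hq2, hb2,
      rfl⟩⟩
  · have r5 := reach_of_iterate hx (iterate_reject (cur := []) (out := out) hb')
      (within_enc hd hC' hi.le le_rfl hw2 (add_comm 1 (n * n)).le hs2 ht2 hq2 hb2)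
    exact ⟨_, (r4.trans r5).mono (by unfold testTime; omega), Or.inr ⟨fun h => hb' (hfe.1 h), C', n,
      w2, _, s2, 0, q2, b', hC', le_rfl, hw2, (add_comm 1 (n * n)).le, hs2, by omega, hq2, hb2,
      rfl⟩⟩

/-- From the configuration `c`, the machine finishes the records in `l` and halts. It finishes the
first of them, or halts, after at most `k` steps, and at least one in any `δ` consecutive steps. -/
def Finishes (x : ℕ → ℕ) (n δ k : ℕ) (c : Config) (l : List (List ℕ)) : Prop :=
  ∃ t, Halted prog ((step prog x)^[t] c) ∧ ((step prog x)^[t] c).cur = [] ∧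
    ((step prog x)^[t] c).out = c.out ++ l ∧
    (∀ r ≤ t, space ((step prog x)^[r] c).mem ≤ spaceBound n) ∧
    (∀ r, r + δ ≤ t →
      ((step prog x)^[r] c).out.length < ((step prog x)^[r + δ] c).out.length) ∧
    (t ≤ k ∨ ∃ r ≤ k, c.out.length < ((step prog x)^[r] c).out.length)

theorem length_out_le_step (c : Config) : c.out.length ≤ (step prog x c).out.length := by
  unfold step
  split
  · exact le_rfl
  · rename_i i _
    cases i <;> simp [exec]

theorem length_out_mono (c : Config) :
    Monotone fun r => ((step prog x)^[r] c).out.length :=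
  monotone_nat_of_le_succ fun r => by
    rw [Function.iterate_succ_apply']
    exact length_out_le_step _

/-- A window of `δ` steps that starts in the prefix of length `j` extends beyond time `j + k`, so it
contains the first record of the continuation, or else the machine halts too early for the window to
count. -/
theorem Finishes.prepend {δ j k : ℕ} {c : Config} {l : List (List ℕ)}
    (hsp : ∀ r ≤ j, space ((step prog x)^[r] c).mem ≤ spaceBound n)
    (h : Finishes x n δ k ((step prog x)^[j] c) l) (hδ : j + k < δ) :
    ∃ t, Halted prog ((step prog x)^[t + j] c) ∧ ((step prog x)^[t + j] c).cur = [] ∧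
    ((step prog x)^[t + j] c).out = ((step prog x)^[j] c).out ++ l ∧
    (∀ r ≤ t + j, space ((step prog x)^[r] c).mem ≤ spaceBound n) ∧
    (∀ r, r + δ ≤ t + j →
      ((step prog x)^[r] c).out.length < ((step prog x)^[r + δ] c).out.length) ∧
    (t ≤ k ∨ ∃ r ≤ k, ((step prog x)^[j] c).out.length < ((step prog x)^[r + j] c).out.length) := by
  obtain ⟨t, h1, h2, h3, h4, h5, h6⟩ := h
  simp only [← Function.iterate_add_apply] at h1 h2 h3 h4 h5 h6
  refine ⟨t, h1, h2, h3, fun r hr => ?_, fun r hr => ?_, h6⟩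
  · by_cases h : r ≤ j
    · exact hsp r h
    · obtain ⟨r', rfl⟩ : ∃ r', r = r' + j := ⟨r - j, by omega⟩
      exact h4 r' (by omega)
  · by_cases h : j ≤ r
    · obtain ⟨r', rfl⟩ : ∃ r', r = r' + j := ⟨r - j, by omega⟩
      have := h5 r' (by omega)
      rwa [show r' + j + δ = r' + δ + j by ring]
    · rcases h6 with h6 | ⟨r', hr', h6⟩
      · omega
      · exact ((length_out_mono c (show r ≤ j by omega)).trans_lt h6).trans_le
          (length_out_mono c (show r' + j ≤ r + δ by omega))

theorem Finishes.of_reach {δ k₀ k : ℕ} {c c' : Config} {l : List (List ℕ)} (hr : Reach x n k₀ c c')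
    (h : Finishes x n δ k c' l) (hδ : k₀ + k < δ) : Finishes x n δ (k₀ + k) c l := by
  obtain ⟨j, hj, rfl, ho, hsp⟩ := hr
  obtain ⟨t, h1, h2, h3, h4, h5, h6⟩ := h.prepend hsp (by omega)
  rw [ho] at h3 h6
  refine ⟨t + j, h1, h2, h3, h4, h5, ?_⟩
  rcases h6 with h6 | ⟨r', hr', h6⟩
  · exact Or.inl (by omega)
  · exact Or.inr ⟨r' + j, by omega, h6⟩

theorem Finishes.of_emits {δ k₀ k : ℕ} {r : List ℕ} {c c' : Config} {l : List (List ℕ)}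
    (hr : Emits x n k₀ r c c') (h : Finishes x n δ k c' l) (hδ : k₀ + k < δ) :
    Finishes x n δ k₀ c (r :: l) := by
  obtain ⟨j, hj, rfl, ho, hsp⟩ := hr
  obtain ⟨t, h1, h2, h3, h4, h5, -⟩ := h.prepend hsp (by omega)
  rw [ho] at h3
  exact ⟨t + j, h1, h2, by simpa using h3, h4, h5, Or.inr ⟨j, hj, by simp [ho]⟩⟩

theorem Finishes.mono {δ k k' : ℕ} {c : Config} {l : List (List ℕ)} (h : Finishes x n δ k c l)
    (hk : k ≤ k') : Finishes x n δ k' c l := by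
  obtain ⟨t, h1, h2, h3, h4, h5, h6⟩ := h
  exact ⟨t, h1, h2, h3, h4, h5, h6.imp (fun h => h.trans hk) fun ⟨r, hr, h⟩ => ⟨r, hr.trans hk, h⟩⟩

open Classical in
/-- The feasible sets that are obtained from `D` by adding elements less than `i`, in the order in
which the program finds them. -/
def listing (F : Finset ℕ → Prop) : ℕ → Finset ℕ → List (Finset ℕ)
  | 0, D => [D]
  | i + 1, D => listing F i D ++ if F (insert i D) then listing F i (insert i D) else []

/-- If `E` is feasible and contains `i`, its part at or above `i` is a subset and hence feasible, so
no feasible set is lost by pruning. -/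
theorem mem_listing {F : Finset ℕ → Prop} (hF : ∀ D E, D ⊆ E → F E → F D) (i : ℕ) :
    ∀ {D E : Finset ℕ}, F D → (∀ j ∈ D, i ≤ j) →
      (E ∈ listing F i D ↔ F E ∧ E.filter (i ≤ ·) = D) := by
  induction i with
  | zero =>
    intro D E hD _
    simp only [listing, List.mem_singleton, zero_le, Finset.filter_true]
    exact ⟨fun h => ⟨h ▸ hD, h⟩, fun h => h.2⟩
  | succ i ih =>
    intro D E hD hi
    have hiD : i ∉ D := fun h => absurd (hi i h) (by omega)
    have h1 := ih (E := E) hD fun j hj => (hi j hj).trans' (by omega)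
    have h2 : F (insert i D) → (E ∈ listing F i (insert i D) ↔
        F E ∧ E.filter (i ≤ ·) = insert i D) := fun h => ih h fun j hj => by
      rcases Finset.mem_insert.1 hj with rfl | hj
      · exact le_rfl
      · exact (hi j hj).trans' (by omega)
    have h3 : E.filter (i ≤ ·) = insert i D → F E → F (insert i D) := fun h hE =>
      hF _ _ (h ▸ Finset.filter_subset _ _) hE
    have h4 : E.filter (i + 1 ≤ ·) = D ↔
        (E.filter (i ≤ ·) = D ∨ E.filter (i ≤ ·) = insert i D) := by
      by_cases hE : i ∈ E
      · have : E.filter (i ≤ ·) = insert i (E.filter (i + 1 ≤ ·)) := by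
          ext j
          simp only [Finset.mem_filter, Finset.mem_insert]
          constructor
          · rintro ⟨h, h'⟩
            rcases h'.eq_or_lt with rfl | h'
            · exact Or.inl rfl
            · exact Or.inr ⟨h, h'⟩
          · rintro (rfl | ⟨h, h'⟩)
            · exact ⟨hE, le_rfl⟩
            · exact ⟨h, by omega⟩
        rw [this]
        constructor
        · rintro h; rw [h]; exact Or.inr rfl
        · rintro (h | h)
          · exact absurd (h ▸ Finset.mem_insert_self _ _) hiD
          · have h' := congrArg (Finset.erase · i) h
            simpa [Finset.erase_insert hiD] using h'
      · have : E.filter (i ≤ ·) = E.filter (i + 1 ≤ ·) := by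
          refine Finset.filter_congr fun j hj => ?_
          have : j ≠ i := fun h => hE (h ▸ hj)
          omega
        rw [this]
        refine ⟨Or.inl, fun h => h.resolve_right fun h => ?_⟩
        have : i ∈ E.filter (i + 1 ≤ ·) := h ▸ Finset.mem_insert_self _ _
        simp at this
    rw [listing, List.mem_append, h1, h4]
    by_cases h : F (insert i D)
    · rw [if_pos h, h2 h]; tauto
    · rw [if_neg h]
      simp only [List.not_mem_nil, or_false]
      tauto

theorem nodup_listing {F : Finset ℕ → Prop} (hF : ∀ D E, D ⊆ E → F E → F D) (i : ℕ) :
    ∀ {D : Finset ℕ}, F D → (∀ j ∈ D, i ≤ j) → (listing F i D).Nodup := by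
  induction i with
  | zero => intro D _ _; simp [listing]
  | succ i ih =>
    intro D hD hi
    have hiD : i ∉ D := fun h => absurd (hi i h) (by omega)
    have hi1 : ∀ j ∈ D, i ≤ j := fun j hj => (hi j hj).trans' (by omega)
    rw [listing]
    by_cases h : F (insert i D)
    · have hi2 : ∀ j ∈ insert i D, i ≤ j := fun j hj => by
        rcases Finset.mem_insert.1 hj with rfl | hj
        exacts [le_rfl, hi1 j hj]
      rw [if_pos h]
      refine (ih hD hi1).append (ih h hi2) fun E h1 h2 => ?_
      rw [mem_listing hF i hD hi1] at h1
      rw [mem_listing hF i h hi2] at h2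
      exact hiD ((h1.2.symm.trans h2.2) ▸ Finset.mem_insert_self _ _)
    · rw [if_neg h, List.append_nil]; exact ih hD hi1

/-- A bound for the time until the next record is finished, from the moment when the digit `i` is
about to be increased. -/
def carryTime (n i : ℕ) : ℕ := 2 + (12 * n + 5) + (n - i) * (testTime n + 9)

/-- A bound for the delay of the machine. -/
def delay (n : ℕ) : ℕ := 12 * n + 5 + carryTime n 0 + 1

theorem carryTime_le (n i : ℕ) : carryTime n i ≤ carryTime n 0 :=
  Nat.add_le_add_left (Nat.mul_le_mul_right _ (by omega)) _

theorem carryTime_succ {n i : ℕ} (hi : i < n) :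
    carryTime n i = carryTime n (i + 1) + (testTime n + 9) := by
  unfold carryTime
  rw [show n - i = n - (i + 1) + 1 by omega, add_mul, one_mul, ← add_assoc]

/-- The argument is in continuation style: `l` is what remains to be written once the carry leaves
the digits below `i`. For digit `i`, the sets without `i` come first; then `insert i D` is tested
and, if feasible, explored; in both cases clearing `i` passes the carry on to `i + 1`. -/
theorem finishes_of_atOut (hx : IsInput x n) (i : ℕ) (hi : i ≤ n) :
    ∀ (D : Finset ℕ) (l : List (List ℕ)), (∀ j ∈ D, i ≤ j) →
      (∀ c, AtCarry n D i c → Finishes x n (delay n) (carryTime n i) c l) →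
      ∀ c, AtOut x n D c → Finishes x n (delay n) (12 * n + 5) c
        ((listing (Feasible x n) i D).map (setRecord x n) ++ l) := by
  induction i with
  | zero =>
    intro D l _ H c hc
    obtain ⟨c', he, hc'⟩ := hc.emits hx
    simpa [listing] using Finishes.of_emits he (H c' hc') (by unfold delay; omega)
  | succ i ih =>
    intro D l hD H c hc
    have hin : i < n := hi
    have hiD : i ∉ D := fun h => absurd (hD i h) (by omega)
    have hD1 : ∀ j ∈ D, i ≤ j := fun j hj => (hD j hj).trans' (by omega)
    have hD2 : ∀ j ∈ insert i D, i ≤ j := fun j hj => by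
      rcases Finset.mem_insert.1 hj with rfl | hj
      exacts [le_rfl, hD1 j hj]
    have hct := carryTime_succ hin
    have hle := carryTime_le n i
    have hclear : ∀ c, AtCarry n (insert i D) i c →
        Finishes x n (delay n) (9 + carryTime n (i + 1)) c l := fun c hc => by
      obtain ⟨c', hr, hc'⟩ := hc.clear hx hin (Finset.mem_insert_self _ _)
      rw [Finset.erase_insert hiD] at hc'
      exact (H c' hc').of_reach hr (by unfold delay; omega)
    have h0 : 12 * n + 5 ≤ carryTime n (i + 1) := by unfold carryTime; omega
    rw [listing, List.map_append, List.append_assoc]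
    refine ih hin.le D _ hD1 (fun c hc => ?_) c hc
    obtain ⟨c', hr, ⟨hf, hc'⟩ | ⟨hf, hc'⟩⟩ := hc.test hx hin hiD
    · rw [if_pos hf]
      have := ih hin.le (insert i D) l hD2
        (fun c hc => (hclear c hc).mono (by omega)) c' hc'
      exact (this.of_reach hr (by unfold delay; omega)).mono (by omega)
    · rw [if_neg hf]
      exact ((hclear c' hc').of_reach hr (by unfold delay; omega)).mono (by omega)

theorem feasible_empty : Feasible x n ∅ := fun _ _ h => absurd h (Finset.notMem_empty _)

/-- The empty set is written without a counting pass; the zero-initialized count array is already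
correct for it. -/
theorem count_empty (hx : IsInput x n) (u : ℕ) : count x n (indic ∅) u = 0 := by
  have : ∀ k, x (1 + u * n + k) - 1 = 0 := fun k => by
    have := hx.2 (1 + u * n + k) (by omega); omega
  simp [count, indic, this]

theorem finishes_init (hx : IsInput x n) :
    Finishes x n (delay n) (delay n) init
      ((listing (Feasible x n) n ∅).map (setRecord x n)) := by
  have h0 : Within (12 + 2 * n) (cellBound n) init.mem := ⟨by simp [init], by simp [init]⟩
  have hr := reach_of_iterate hx (iterate_init hx.1) h0
  have hind : indic ∅ = fun _ => 0 := funext fun j => by simp [indic]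
  have hout : AtOut x n ∅ ⟨4, enc n (fun _ => 0) (fun _ => 0) 0 0 0 0 0 0 0 0, [], []⟩ := by
    refine ⟨fun _ => 0, 0, 0, 0, 0, 0, 0, 0, 0, fun _ => Nat.zero_le _,
      fun j _ => (count_empty hx j).symm,
      by omega, by omega, by omega, by omega, by omega, by omega, by omega, by omega, ?_⟩
    rw [hind]
  have := finishes_of_atOut hx n le_rfl ∅ [] (by simp) (fun c hc => ?_) _ hout
  · rw [List.append_nil] at this
    exact (this.of_reach hr (by unfold delay carryTime; omega)).mono
      (by unfold delay carryTime; omega)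
  · obtain ⟨c', hr, hh, hcur⟩ := hc.halts hx
    have : Finishes x n (delay n) 0 c' [] := by
      obtain ⟨j, -, rfl, -, hsp⟩ := hr
      exact ⟨0, hh, hcur, by simp, fun r hr => by
        rw [Nat.le_zero.1 hr]; exact hsp j le_rfl, fun r hr => by unfold delay at hr; omega,
        Or.inl le_rfl⟩
    exact (this.of_reach hr (by unfold delay carryTime; omega)).mono (by unfold carryTime; omega)

end

/-! ### Correctness on graph inputs and the total time -/

section
open Roman
variable {n : ℕ} (G : SimpleGraph (Fin n))

open Classical in
theorem graphInput_eq (i j : Fin n) :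
    graphInput G (1 + i * n + j) = if G.Adj i j then 1 else 0 := by
  unfold graphInput
  rw [if_neg (by omega)]
  refine if_congr ⟨?_, fun h => ⟨i, j, rfl, h⟩⟩ rfl rfl
  rintro ⟨i', j', h, hadj⟩
  -- Row-major indexing is injective on pairs from `Fin n`.
  have : finProdFinEquiv (i, j) = finProdFinEquiv (i', j') := by
    ext
    simp only [finProdFinEquiv_apply_val]
    linarith
  obtain ⟨rfl, rfl⟩ := Prod.mk.inj (finProdFinEquiv.injective this)
  exact hadj

theorem isInput_graphInput : IsInput (graphInput G) n := by
  refine ⟨by simp [graphInput], fun k hk => ?_⟩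
  unfold graphInput
  rw [if_neg hk]
  split_ifs <;> omega

/-- The set of vertices with numbers in `D`. -/
def verts (n : ℕ) (D : Finset ℕ) : Set (Fin n) := {v | (v : ℕ) ∈ D}

open Classical in
theorem count_graphInput (D : Finset ℕ) (u : Fin n) :
    count (graphInput G) n (indic D) u =
      2 * (if u ∈ verts n D then 1 else 0) +
        (Finset.univ.filter fun w => G.Adj u w ∧ w ∈ verts n D).card := by
  have hi : indic D u = if u ∈ verts n D then 1 else 0 := by
    by_cases h : (u : ℕ) ∈ D <;> simp [indic, verts, h]
  rw [count, Finset.sum_range, Finset.card_filter, two_mul, hi]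
  refine congrArg _ (Finset.sum_congr rfl fun w _ => ?_)
  rw [graphInput_eq]
  by_cases h1 : G.Adj u w <;> by_cases h2 : (w : ℕ) ∈ D <;> simp [h1, h2, indic, verts]

theorem isOne_eq (c : ℕ) : isOne c = if c = 1 then 1 else 0 := by
  unfold isOne; split_ifs <;> omega

open Classical in
theorem privates_graphInput (C : ℕ → ℕ) (v : Fin n) :
    privates (graphInput G) n C v ≠ 0 ↔ ∃ u, G.Adj v u ∧ C (u : ℕ) = 1 := by
  rw [privates, Finset.sum_range, Ne, Finset.sum_eq_zero_iff]
  push Not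
  refine exists_congr fun u => ?_
  rw [graphInput_eq, isOne_eq]
  by_cases h1 : G.Adj v u <;> by_cases h2 : C (u : ℕ) = 1 <;> simp [h1, h2]

/-- The extra 2 for members makes a count of 1 mean both that `u` is outside the set and that
exactly one of its neighbors is inside. -/
theorem feasible_graphInput (D : Finset ℕ) :
    Feasible (graphInput G) n D ↔ HasPrivate G (verts n D) := by
  classical
  have h0 : Feasible (graphInput G) n D ↔ ∀ v : Fin n, (v : ℕ) ∈ D →
      privates (graphInput G) n (count (graphInput G) n (indic D)) v ≠ 0 :=
    ⟨fun h v hv => h v v.2 hv, fun h v hv hD => h ⟨v, hv⟩ hD⟩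
  rw [h0]
  refine forall_congr' fun v => imp_congr_right fun hv => ?_
  rw [privates_graphInput]
  refine exists_congr fun u => and_congr_right fun hvu => ?_
  rw [count_graphInput]
  have hmem : v ∈ Finset.univ.filter fun w => G.Adj u w ∧ w ∈ verts n D := by
    simp [hvu.symm]; exact hv
  by_cases hu : u ∈ verts n D
  · simp [hu]
    omega
  · simp only [hu, if_false, mul_zero, zero_add, not_false_eq_true, true_and]
    constructor
    · intro h w hw hwD
      exact Finset.card_le_one.1 h.le w (by simp [hw, hwD]) v hmem
    · intro h
      refine Finset.card_eq_one.2 ⟨v, Finset.eq_singleton_iff_unique_mem.2 ⟨hmem, fun w hw => ?_⟩⟩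
      have hw := (Finset.mem_filter.1 hw).2
      exact h w hw.1 hw.2

theorem setRecord_graphInput (D : Finset ℕ) :
    setRecord (graphInput G) n D = record (ofSet G (verts n D)) := by
  classical
  rw [setRecord, record]
  refine List.ext_getElem (by simp) fun k h1 h2 => ?_
  have hk : k < n := by simpa using h2
  simp only [List.getElem_map, List.getElem_range', List.getElem_ofFn, outVal, zero_add, one_mul]
  have hc := count_graphInput G D ⟨k, hk⟩
  simp only at hc
  rw [hc]
  have hi : indic D k = if (⟨k, hk⟩ : Fin n) ∈ verts n D then 1 else 0 := by
    by_cases h : k ∈ D <;> simp [indic, verts, h]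
  rw [hi]
  unfold ofSet
  by_cases hD : (⟨k, hk⟩ : Fin n) ∈ verts n D
  · simp [hD]
    omega
  · simp only [hD, if_false, mul_zero, zero_add]
    by_cases h : ∃ u, G.Adj ⟨k, hk⟩ u ∧ u ∈ verts n D
    · rw [if_pos h]
      obtain ⟨u, hu⟩ := h
      have : 0 < (Finset.univ.filter fun w => G.Adj ⟨k, hk⟩ w ∧ w ∈ verts n D).card :=
        Finset.card_pos.2 ⟨u, by simp [hu]⟩
      simp; omega
    · rw [if_neg h, Finset.card_eq_zero.2]
      · rfl
      · rw [Finset.filter_eq_empty_iff]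
        exact fun w _ hw => h ⟨w, hw⟩

theorem record_injective : Function.Injective (record (n := n)) := fun f g h => by
  have := List.ofFn_injective h
  funext v
  exact Fin.ext (congrFun this v)

theorem verts_injOn : Set.InjOn (verts n) {D | D ⊆ Finset.range n} := fun D hD E hE h => by
  ext j
  have key : ∀ hj : j < n, j ∈ D ↔ j ∈ E := fun hj => Set.ext_iff.1 h ⟨j, hj⟩
  exact ⟨fun hj => (key (Finset.mem_range.1 (hD hj))).1 hj,
    fun hj => (key (Finset.mem_range.1 (hE hj))).2 hj⟩

theorem mem_listing_graphInput {E : Finset ℕ} :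
    E ∈ listing (Feasible (graphInput G) n) n ∅ ↔
      HasPrivate G (verts n E) ∧ E ⊆ Finset.range n := by
  rw [mem_listing _ n feasible_empty (by simp), feasible_graphInput, Finset.filter_eq_empty_iff]
  · simp [Finset.subset_iff]
  · intro D E h hE
    rw [feasible_graphInput] at hE ⊢
    exact hE.mono fun v hv => h hv

theorem nodup_listing_graphInput :
    ((listing (Feasible (graphInput G) n) n ∅).map (setRecord (graphInput G) n)).Nodup := by
  refine List.Nodup.map_on (fun D hD E hE h => ?_) (nodup_listing ?_ n feasible_empty (by simp))
  · rw [setRecord_graphInput, setRecord_graphInput] at h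
    exact verts_injOn ((mem_listing_graphInput G).1 hD).2 ((mem_listing_graphInput G).1 hE).2
      (ofSet_injective G (record_injective h))
  · intro D E h hE
    rw [feasible_graphInput] at hE ⊢
    exact hE.mono fun v hv => h hv

theorem mem_map_listing_graphInput (r : List ℕ) :
    r ∈ (listing (Feasible (graphInput G) n) n ∅).map (setRecord (graphInput G) n) ↔
      r ∈ record '' {f | IsMinimalRDF G f} := by
  rw [setOf_isMinimalRDF, List.mem_map]
  constructor
  · rintro ⟨E, hE, rfl⟩
    exact ⟨_, ⟨_, ((mem_listing_graphInput G).1 hE).1, rfl⟩, (setRecord_graphInput G E).symm⟩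
  · rintro ⟨_, ⟨D, hD, rfl⟩, rfl⟩
    classical
    have : verts n ((Finset.univ.filter (· ∈ D)).map Fin.valEmbedding) = D := by
      ext v
      simp [verts, Fin.val_inj]
    refine ⟨(Finset.univ.filter (· ∈ D)).map Fin.valEmbedding,
      (mem_listing_graphInput G).2 ⟨by rwa [this], fun j hj => ?_⟩,
      by rw [setRecord_graphInput, this]⟩
    obtain ⟨v, -, rfl⟩ := Finset.mem_map.1 hj
    simp

/-- Each of the consecutive disjoint windows of length `δ` contributes a new record. -/
theorem time_le_of_delay {P : Program} {x : ℕ → ℕ} {δ t : ℕ} (hδ : 0 < δ)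
    (h : ∀ r, r + δ ≤ t → (run P x r).out.length < (run P x (r + δ)).out.length)
    (hm : ∀ r, r ≤ t → (run P x r).out.length ≤ (run P x t).out.length) :
    t ≤ δ * ((run P x t).out.length + 1) := by
  have key : ∀ j, j * δ ≤ t → j ≤ (run P x (j * δ)).out.length := fun j => by
    induction j with
    | zero => intro _; exact Nat.zero_le _
    | succ j ih =>
      intro hj
      rw [add_mul, one_mul] at hj ⊢
      have := ih (by omega)
      have := h _ hj
      omega
  by_contra hlt
  push Not at hlt
  have h1 : ((run P x t).out.length + 1) * δ ≤ t := by rw [mul_comm]; exact hlt.le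
  have := key _ h1
  have := hm _ h1
  omega

theorem exists_polynomial_delay : ∃ P : Polynomial ℕ, ∀ n, P.eval n = delay n :=
  ⟨12 * .X + 5 + (2 + (12 * .X + 5) +
    .X * (8 + (11 * .X + 12) * .X + 5 + (15 * .X + 12) * .X + 4 + 9)) + 1, fun n => by
    simp [delay, carryTime, testTime]⟩

theorem exists_polynomial_spaceBound : ∃ P : Polynomial ℕ, ∀ n, P.eval n = spaceBound n :=
  ⟨(12 + 2 * .X + 20) * (2 * (2 ^ 20 * (.X * .X + 3 * .X + 20 + (.X + 1 + 12)))), fun n => by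
    simp only [spaceBound, cellBound, Polynomial.eval_add, Polynomial.eval_mul, Polynomial.eval_X,
      Polynomial.eval_ofNat, Polynomial.eval_one, Polynomial.eval_pow]⟩

/-- Acyclicity enters only through the number of records. The factor 2 absorbs the one extra delay,
since `√3 ^ n ≥ 1`. -/
theorem enumerates_prog (hG : G.IsAcyclic) :
    Enumerates prog (graphInput G) (record '' {f | IsMinimalRDF G f})
      (((2 * delay n : ℕ) : ℝ) * √3 ^ n) (delay n) (spaceBound n) := by
  obtain ⟨t, hh, hcur, hout, hsp, hδ, -⟩ := finishes_init (isInput_graphInput G)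
  change (run _ _ t).out = [] ++ _ at hout
  rw [List.nil_append] at hout
  have hnd := nodup_listing_graphInput G
  have hmem := mem_map_listing_graphInput G
  rw [← hout] at hnd hmem
  refine ⟨t, ?_, hh, hcur, hnd, hmem, hδ, hsp⟩
  have h1 := time_le_of_delay (by unfold delay; omega) hδ fun r hr => length_out_mono init hr
  have h2 : ((run prog (graphInput G) t).out.length : ℝ) ≤ √3 ^ n := by
    classical
    have h3 : (run prog (graphInput G) t).out.length = {f | IsMinimalRDF G f}.ncard := by
      rw [← Set.ncard_image_of_injective _ record_injective, ← List.toFinset_card_of_nodup hnd,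
        ← Set.ncard_coe_finset]
      congr 1
      ext r
      rw [← hmem r]
      simp
    rw [h3]
    simpa using ncard_isMinimalRDF_le hG
  have h4 : (1 : ℝ) ≤ √3 ^ n := one_le_pow₀ (Real.one_le_sqrt.2 (by norm_num))
  have h5 : (t : ℝ) ≤ (delay n : ℝ) * ((run prog (graphInput G) t).out.length + 1) := by
    exact_mod_cast h1
  have h6 : (0 : ℝ) ≤ delay n := Nat.cast_nonneg _
  push_cast
  nlinarith [mul_le_mul_of_nonneg_left h2 h6, mul_le_mul_of_nonneg_left h4 h6]

end

end RAM

end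

theorem mainTheorem2 :
    -- the number of minimal Roman dominating functions of a forest
    (∀ (V : Type*) [Fintype V] (G : SimpleGraph V), G.IsAcyclic →
      ({f : V → Fin 3 | Roman.IsMinimalRDF G f}.ncard : ℝ) ≤ Real.sqrt 3 ^ Fintype.card V) ∧
    -- their enumeration: total time, delay and space
    (∃ (P : RAM.Program) (p d b : Polynomial ℕ),
      ∀ (n : ℕ) (G : SimpleGraph (Fin n)), G.IsAcyclic →
        RAM.Enumerates P (RAM.graphInput G) (RAM.record '' {f | Roman.IsMinimalRDF G f})
          (((p.eval n : ℕ) : ℝ) * Real.sqrt 3 ^ n) (d.eval n) (b.eval n)) ∧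
    -- the bound is attained
    (∀ m : ℕ, (Roman.disjointP2 m).IsAcyclic ∧
      ({f : Fin m × Fin 2 → Fin 3 | Roman.IsMinimalRDF (Roman.disjointP2 m) f}.ncard : ℝ) =
        Real.sqrt 3 ^ Fintype.card (Fin m × Fin 2)) := by
  refine ⟨fun V _ G hG => Roman.ncard_isMinimalRDF_le hG, ?_, fun m =>
    ⟨Roman.isAcyclic_disjointP2 m, ?_⟩⟩
  · obtain ⟨d, hd⟩ := RAM.exists_polynomial_delay
    obtain ⟨b, hb⟩ := RAM.exists_polynomial_spaceBound
    refine ⟨RAM.prog, 2 * d, d, b, fun n G hG => ?_⟩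
    rw [hb, Polynomial.eval_mul, hd, Polynomial.eval_ofNat]
    exact RAM.enumerates_prog G hG
  · rw [Roman.ncard_isMinimalRDF_disjointP2, Roman.sqrt_three_pow_card_disjointP2]
    norm_num
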